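/- Let $X,U$ be Banach spaces over $\mathbb K\in\{\mathbb R,\mathbb C\}$. A boundary control system (BCS) $$\dot x(t)=\hat A x(t),\quad x(0)=x_0,\qquad \hat G x(t)=u(t) \tag{1}$$ consists of linear operators $\hat A:D(\hat A)\subset X\to X$ and $\hat G:D(\hat G)\subset X\to U$ with $D(\hat A)\subset D(\hat G)$ such that (i) the operator $A$ with $D(A)=D(\hat A)\cap\ker\hat G$ and $Ax=\hat Ax$ for $x\in D(A)$ generates a $C_0$-semigroup $(T(t))_{t\ge 0}$ on $X$, and (ii) there is a lifting operator, i.e. a $G\in L(U,X)$ with $Gv\in D(\hat A)$ and $\hat GGv=v$ for all $v\in U$, and $\hat AG\in L(U,X)$. A classical solution of (1) on $[0,\tau]$ is a continuously differentiable $x:[0,\tau]\to X$ (one-sided derivatives at the end points) with $x(t)\in D(\hat A)$ for all $t\in[0,\tau]$ that satisfies (1) for all $t\in[0,\tau]$. For $a\in\rho(A)$, let $X_{-1}$ be the completion of $X$ with respect to the norm $\|(aI-A)^{-1}x\|_X$, let $T_{-1}(t)$ be the extension by continuity of $T(t)$ to $X_{-1}$, and let $A_{-1}$ be the generator of $T_{-1}$.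 \textbf{Theorem.} Consider a BCS (1), and let $G$ be any lifting operator for it. For every $\tau\ge 0$, every $u\in C^2([0,\tau],U)$ and every $x_0\in X$ with $x_0-Gu(0)\in D(A)$, the classical solution $\phi(\cdot,x_0,u)$ of (1) on $[0,\tau]$ exists and is unique, and for all $t\in[0,\tau]$ (all integrals exist as Bochner integrals, in $X$ for the first two representations and in $X_{-1}$ for the third, and $\int_0^tT(t-r)Gu(r)\,dr\in D(A)$) \begin{align*} \phi(t,x_0,u)&=T(t)\big(x_0-Gu(0)\big)+\int_0^tT(t-r)\big(\hat AGu(r)-G\dot u(r)\big)\,dr+Gu(t)\\ &=T(t)x_0+\int_0^tT(t-r)\hat AGu(r)\,dr-A\int_0^tT(t-r)Gu(r)\,dr\\ &=T(t)x_0+\int_0^tT_{-1}(t-r)\big(\hat AG-A_{-1}G\big)u(r)\,dr . \end{align*} Here $\rho(A)\neq\emptyset$, and for every $a\in\rho(A)$ used to form $X_{-1}$: $T_{-1}$ is a $C_0$-semigroup on $X_{-1}$ extending $T$, its generator $A_{-1}$ extends $A$ and has domain $X$ (with $X$ regarded as a subspace of $X_{-1}$), and the third representation holds as an identity in $X_{-1}$.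 Furthermore, $A_{-1}G\in L(U,X_{-1})$ (and thus $\hat AG-A_{-1}G\in L(U,X_{-1})$). -/

import Mathlib

open Filter Topology MeasureTheory Set

noncomputable section

namespace BCS

/-! ### Strongly continuous semigroups and their generators

Throughout, `𝕜` is `ℝ` or `ℂ`.  The real structure on a `𝕜`-normed space is used for time
derivatives and for Bochner integrals. -/

section Semigroups

variable {𝕜 X : Type*} [RCLike 𝕜] [NormedAddCommGroup X] [NormedSpace 𝕜 X]

/-- `(T t)_{t ≥ 0}` is a `C₀`-semigroup of bounded operators (values at `t < 0` are irrelevant). -/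
structure IsC0Semigroup (T : ℝ → X →L[𝕜] X) : Prop where
  map_zero : T 0 = ContinuousLinearMap.id 𝕜 X
  map_add : ∀ s t : ℝ, 0 ≤ s → 0 ≤ t → T (s + t) = (T s).comp (T t)
  tendsto_zero : ∀ x : X, Tendsto (fun t : ℝ => T t x) (𝓝[>] 0) (𝓝 x)

/-- The difference quotients of `t ↦ T t x` at `0` converge to `y` as `h → 0`, `h > 0`. -/
def HasGeneratorValue [NormedSpace ℝ X] (T : ℝ → X →L[𝕜] X) (x y : X) : Prop :=
  Tendsto (fun h : ℝ => h⁻¹ • (T h x - x)) (𝓝[>] 0) (𝓝 y)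

theorem HasGeneratorValue.add [NormedSpace ℝ X] {T : ℝ → X →L[𝕜] X} {x y x' y' : X}
    (h₁ : HasGeneratorValue T x y) (h₂ : HasGeneratorValue T x' y') :
    HasGeneratorValue T (x + x') (y + y') := by
  refine (Tendsto.add h₁ h₂).congr fun h => ?_
  rw [← smul_add, map_add]
  congr 1
  abel

theorem HasGeneratorValue.smul [NormedSpace ℝ X] [IsScalarTower ℝ 𝕜 X] {T : ℝ → X →L[𝕜] X}
    {x y : X} (c : 𝕜) (h₁ : HasGeneratorValue T x y) :
    HasGeneratorValue T (c • x) (c • y) := by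
  have : SMulCommClass ℝ 𝕜 X := IsScalarTower.to_smulCommClass
  refine (Tendsto.const_smul h₁ c).congr fun h => ?_
  rw [map_smul, ← smul_sub, smul_comm]

/-- The infinitesimal generator of `T`: its domain consists of the `x` for which
`lim_{h → 0+} (T h x - x) / h` exists, and its value at `x` is this limit. -/
def generator [NormedSpace ℝ X] [IsScalarTower ℝ 𝕜 X] (T : ℝ → X →L[𝕜] X) : X →ₗ.[𝕜] X where
  domain :=
    { carrier := {x | ∃ y, HasGeneratorValue T x y}
      add_mem' := fun ⟨y, hy⟩ ⟨y', hy'⟩ => ⟨y + y', hy.add hy'⟩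
      zero_mem' := ⟨0, by simp [HasGeneratorValue]⟩
      smul_mem' := fun c _ ⟨y, hy⟩ => ⟨c • y, hy.smul c⟩ }
  toFun :=
    { toFun := fun x => x.2.choose
      map_add' := fun x x' => tendsto_nhds_unique (x + x').2.choose_spec
        (HasGeneratorValue.add x.2.choose_spec x'.2.choose_spec)
      map_smul' := fun c x => tendsto_nhds_unique (c • x).2.choose_spec
        (HasGeneratorValue.smul c x.2.choose_spec) }

end Semigroups

/-! ### Resolvent set and resolvent of an unbounded operator -/

section Resolvent

variable {𝕜 X : Type*} [RCLike 𝕜] [NormedAddCommGroup X] [NormedSpace 𝕜 X]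

/-- The bounded operator `R` is a two-sided inverse of `a I - A : D(A) → X`. -/
def IsResolventAt (A : X →ₗ.[𝕜] X) (a : 𝕜) (R : X →L[𝕜] X) : Prop :=
  (∀ y : X, ∃ h : R y ∈ A.domain, a • R y - A ⟨R y, h⟩ = y) ∧
    ∀ x : A.domain, R (a • (x : X) - A x) = x

/-- The resolvent set `ρ(A)`. -/
def resolventSet (A : X →ₗ.[𝕜] X) : Set 𝕜 := {a | ∃ R : X →L[𝕜] X, IsResolventAt A a R}

open Classical in
/-- The resolvent `(a I - A)⁻¹`, for `a ∈ ρ(A)` (and `0` otherwise). -/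
def resolvent (A : X →ₗ.[𝕜] X) (a : 𝕜) : X →L[𝕜] X :=
  if h : ∃ R : X →L[𝕜] X, IsResolventAt A a R then h.choose else 0

theorem resolvent_spec {A : X →ₗ.[𝕜] X} {a : 𝕜} (ha : a ∈ resolventSet A) :
    IsResolventAt A a (resolvent A a) := by
  have h : ∃ R : X →L[𝕜] X, IsResolventAt A a R := ha
  rw [resolvent, dif_pos h]
  exact h.choose_spec

end Resolvent

/-! ### The extrapolation space -/

section Extrapolation

variable {𝕜 X : Type*} [RCLike 𝕜] [NormedAddCommGroup X] [NormedSpace 𝕜 X]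

/-- The vector space `X`, to be equipped with the (semi)norm `x ↦ ‖R x‖`. -/
def Pullback (_R : X →L[𝕜] X) : Type _ := X

instance (R : X →L[𝕜] X) : AddCommGroup (Pullback R) := inferInstanceAs (AddCommGroup X)

instance (R : X →L[𝕜] X) : Module 𝕜 (Pullback R) := inferInstanceAs (Module 𝕜 X)

/-- The identity, as a linear equivalence from `X` to `Pullback R`. -/
def toPullback (R : X →L[𝕜] X) : X ≃ₗ[𝕜] Pullback R := LinearEquiv.refl 𝕜 X

instance (R : X →L[𝕜] X) : SeminormedAddCommGroup (Pullback R) :=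
  SeminormedAddCommGroup.induced (Pullback R) X
    ((R : X →ₗ[𝕜] X).comp ((toPullback R).symm : Pullback R →ₗ[𝕜] X))

theorem norm_toPullback (R : X →L[𝕜] X) (x : X) : ‖toPullback R x‖ = ‖R x‖ := rfl

instance (R : X →L[𝕜] X) : NormedSpace 𝕜 (Pullback R) where
  norm_smul_le c x := by
    have h : ‖R (c • (toPullback R).symm x)‖ ≤ ‖c‖ * ‖R ((toPullback R).symm x)‖ := by
      rw [map_smul, norm_smul]
    exact h

section Real

variable [NormedSpace ℝ X] [IsScalarTower ℝ 𝕜 X]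

instance (R : X →L[𝕜] X) : Module ℝ (Pullback R) := inferInstanceAs (Module ℝ X)

instance (R : X →L[𝕜] X) : IsScalarTower ℝ 𝕜 (Pullback R) :=
  inferInstanceAs (IsScalarTower ℝ 𝕜 X)

instance (R : X →L[𝕜] X) : NormedSpace ℝ (Pullback R) where
  norm_smul_le c x := by
    have h : ‖R (c • (toPullback R).symm x)‖ ≤ ‖c‖ * ‖R ((toPullback R).symm x)‖ := by
      rw [R.map_smul_of_tower, norm_smul]
    exact h

end Real

/-- The extrapolation space `X₋₁` of `A`: the completion of `X` with respect to the norm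
`x ↦ ‖(a I - A)⁻¹ x‖`, where `a ∈ ρ(A)`. -/
abbrev ExtrapolationSpace (A : X →ₗ.[𝕜] X) (a : 𝕜) : Type _ :=
  UniformSpace.Completion (Pullback (resolvent A a))

/-- The canonical embedding `X → X₋₁`. -/
def toExtrapolation (A : X →ₗ.[𝕜] X) (a : 𝕜) : X →L[𝕜] ExtrapolationSpace A a :=
  UniformSpace.Completion.toComplL.comp
    ((toPullback (resolvent A a) : X →ₗ[𝕜] Pullback (resolvent A a)).mkContinuous
      ‖resolvent A a‖ fun x => by
        rw [LinearEquiv.coe_coe, norm_toPullback]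
        exact (resolvent A a).le_opNorm x)

/-- `T₋₁`: for each `t`, the extension of `T t` by continuity from (the image of) `X` to `X₋₁`. -/
def extrapolatedSemigroup (A : X →ₗ.[𝕜] X) (a : 𝕜) (T : ℝ → X →L[𝕜] X) (t : ℝ) :
    ExtrapolationSpace A a →L[𝕜] ExtrapolationSpace A a :=
  LinearMap.extendOfNorm
    (((toExtrapolation A a).comp (T t) : X →L[𝕜] ExtrapolationSpace A a) :
      X →ₗ[𝕜] ExtrapolationSpace A a)
    (toExtrapolation A a : X →ₗ[𝕜] ExtrapolationSpace A a)

/-- `A₋₁`: the generator of `T₋₁`. -/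
def extrapolatedGenerator [NormedSpace ℝ X] [IsScalarTower ℝ 𝕜 X]
    (A : X →ₗ.[𝕜] X) (a : 𝕜) (T : ℝ → X →L[𝕜] X) :
    ExtrapolationSpace A a →ₗ.[𝕜] ExtrapolationSpace A a :=
  generator (extrapolatedSemigroup A a T)

end Extrapolation

/-! ### Boundary control systems -/

section BoundaryControl

variable {𝕜 X U : Type*} [RCLike 𝕜] [NormedAddCommGroup X] [NormedSpace 𝕜 X]
  [NormedAddCommGroup U] [NormedSpace 𝕜 U]

/-- The operator `A` with `D(A) = D(Â) ∩ ker Ĝ` and `A x = Â x` for `x ∈ D(A)`. -/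
def homogeneousOperator (Ahat : X →ₗ.[𝕜] X) (Ghat : X →ₗ.[𝕜] U) : X →ₗ.[𝕜] X :=
  Ahat.domRestrict ((LinearMap.ker Ghat.toFun).map Ghat.domain.subtype)

/-- A lifting operator `G ∈ L(U, X)` for the pair `(Â, Ĝ)`: `G v ∈ D(Â)` for all `v`,
`Â G ∈ L(U, X)` and `Ĝ G v = v`.  The bounded operator `Â G` is the field `AhatG`. -/
structure LiftingOperator (Ahat : X →ₗ.[𝕜] X) (Ghat : X →ₗ.[𝕜] U) where
  G : U →L[𝕜] X
  AhatG : U →L[𝕜] X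
  mem_domain : ∀ v, G v ∈ Ahat.domain
  AhatG_apply : ∀ v, AhatG v = Ahat ⟨G v, mem_domain v⟩
  mem_domain_Ghat : ∀ v, G v ∈ Ghat.domain
  Ghat_G : ∀ v, Ghat ⟨G v, mem_domain_Ghat v⟩ = v

variable (𝕜 X U) in
/-- A boundary control system `ẋ = Â x`, `Ĝ x = u` with formal system operator `Â` and boundary
operator `Ĝ`. -/
structure BoundaryControlSystem [NormedSpace ℝ X] [IsScalarTower ℝ 𝕜 X] where
  Ahat : X →ₗ.[𝕜] X
  Ghat : X →ₗ.[𝕜] U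
  domain_le : Ahat.domain ≤ Ghat.domain
  exists_semigroup : ∃ T : ℝ → X →L[𝕜] X,
    IsC0Semigroup T ∧ generator T = homogeneousOperator Ahat Ghat
  exists_lifting : Nonempty (LiftingOperator Ahat Ghat)

/-- The operator `A` of a boundary control system. -/
def BoundaryControlSystem.A [NormedSpace ℝ X] [IsScalarTower ℝ 𝕜 X]
    (S : BoundaryControlSystem 𝕜 X U) : X →ₗ.[𝕜] X :=
  homogeneousOperator S.Ahat S.Ghat

/-- `x` is a classical solution on `[0, τ]` of `ẋ = Â x`, `x 0 = x₀`, `Ĝ x = u`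
(one-sided derivatives at the end points). -/
structure BoundaryControlSystem.IsClassicalSolution [NormedSpace ℝ X] [IsScalarTower ℝ 𝕜 X]
    (S : BoundaryControlSystem 𝕜 X U) (τ : ℝ) (x₀ : X) (u : ℝ → U) (x : ℝ → X) : Prop where
  contDiffOn : ContDiffOn ℝ 1 x (Icc 0 τ)
  initial : x 0 = x₀
  mem_domain : ∀ t ∈ Icc 0 τ, x t ∈ S.Ahat.domain
  hasDerivWithinAt : ∀ (t : ℝ) (ht : t ∈ Icc 0 τ),
    HasDerivWithinAt x (S.Ahat ⟨x t, mem_domain t ht⟩) (Icc 0 τ) t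
  boundary : ∀ (t : ℝ) (ht : t ∈ Icc 0 τ), S.Ghat ⟨x t, S.domain_le (mem_domain t ht)⟩ = u t

end BoundaryControl

end BCS

end

/-! Subtracting the lifted input makes the boundary condition homogeneous: x is a classical solution
exactly when z = x - Gu takes values in D(A) and is a classical solution of z' = Az + f with f = ÂGu
- Gu'. Differentiating r ↦ T(t-r)z(r) forces the variation of constants formula
(`eq_add_convolution`), hence uniqueness and the first representation.

For existence, u ∈ C² makes f a C¹ function, and the convolution T*f of T with such an f lies in
D(A), with A(T*f) = Tf(0) + T*f' - f (`hasGeneratorValue_convolution`). The reason is that, for a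
resolvent R of A, the function Rf lives in D(A) and itself solves an inhomogeneous problem; its
variation of constants formula exhibits T*f as an element of the range of R. The same identity for
Gu in place of f turns the first representation into the second.

For the third, R extends to an isometric isomorphism e : X₋₁ → X with e T₋₁(t) = T(t) e. Thus T₋₁ is
a copy of T, D(A₋₁) = e⁻¹(D(A)) is X, and A₋₁ = e⁻¹(aR - I) on X. Applying e to the third
representation gives R applied to the second.

Two devices keep one-sided issues away: T(max s 0) is strongly continuous on all of ℝ, and inputs on
[0,τ] are extended to C² functions on ℝ. -/

namespace BCS

/-- Right difference quotients of integrals of a continuous function. -/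
theorem tendsto_integral_quotient {E : Type*} [NormedAddCommGroup E] [NormedSpace ℝ E]
    [CompleteSpace E] {f : ℝ → E} (hf : Continuous f) (t : ℝ) :
    Tendsto (fun h : ℝ => h⁻¹ • ∫ s in t..(t + h), f s) (𝓝[>] 0) (𝓝 (f t)) := by
  have h1 := (hf.integral_hasStrictDerivAt t t).hasDerivAt
  have h2 := (hasDerivAt_iff_tendsto_slope_zero.1 h1).mono_left
    (nhdsWithin_mono (0 : ℝ) (s := Ioi 0) (fun x (hx : (0 : ℝ) < x) => hx.ne'))
  simpa using h2

/-! ### Local boundedness and strong continuity of C₀-semigroups. -/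

section SemigroupTheory

variable {𝕜 X : Type*} [RCLike 𝕜] [NormedAddCommGroup X] [NormedSpace 𝕜 X]

namespace IsC0Semigroup

variable {T : ℝ → X →L[𝕜] X}

theorem map_add_apply (hT : IsC0Semigroup T) {s t : ℝ} (hs : 0 ≤ s) (ht : 0 ≤ t) (x : X) :
    T (s + t) x = T s (T t x) := by
  rw [hT.map_add s t hs ht, ContinuousLinearMap.comp_apply]

theorem map_zero_apply (hT : IsC0Semigroup T) (x : X) : T 0 x = x := by
  rw [hT.map_zero, ContinuousLinearMap.id_apply]

theorem comm_apply (hT : IsC0Semigroup T) {s t : ℝ} (hs : 0 ≤ s) (ht : 0 ≤ t) (x : X) :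
    T s (T t x) = T t (T s x) := by
  rw [← hT.map_add_apply hs ht, ← hT.map_add_apply ht hs, add_comm]

theorem tendsto_abs (hT : IsC0Semigroup T) (x : X) :
    Tendsto (fun h : ℝ => T |h| x) (𝓝 0) (𝓝 x) := by
  have h1 : Tendsto (fun h : ℝ => T h x) (𝓝[≥] 0) (𝓝 x) := by
    rw [← Ioi_insert, nhdsWithin_insert, tendsto_sup]
    refine ⟨?_, hT.tendsto_zero x⟩
    rw [tendsto_pure_left]
    intro s hs
    rw [hT.map_zero_apply]
    exact mem_of_mem_nhds hs
  refine h1.comp (tendsto_nhdsWithin_iff.2 ⟨?_, Eventually.of_forall fun h => abs_nonneg h⟩)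
  simpa using (continuous_abs (G := ℝ)).tendsto 0

/-- Factoring out T at the smaller of the two times reduces continuity of an orbit anywhere, from
either side, to continuity at 0. -/
theorem norm_sub_le (hT : IsC0Semigroup T) {s t M : ℝ} (hs : 0 ≤ s) (ht : 0 ≤ t)
    (hsM : ‖T s‖ ≤ M) (htM : ‖T t‖ ≤ M) (x : X) :
    ‖T s x - T t x‖ ≤ M * ‖T |s - t| x - x‖ := by
  wlog h : s ≤ t generalizing s t
  · rw [norm_sub_rev, abs_sub_comm]
    exact this ht hs htM hsM (le_of_not_ge h)
  rw [abs_sub_comm, abs_of_nonneg (sub_nonneg.2 h), norm_sub_rev]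
  have : T t x = T s (T (t - s) x) := by
    rw [← hT.map_add_apply hs (sub_nonneg.2 h), add_sub_cancel]
  rw [this, ← _root_.map_sub]
  exact (T s).le_of_opNorm_le hsM _

variable [CompleteSpace X]

/-- Otherwise there are times s n → 0 with unbounded ‖T (s n)‖, while every orbit converges along
them; this contradicts Banach–Steinhaus. -/
theorem exists_bound_near_zero (hT : IsC0Semigroup T) :
    ∃ δ > 0, ∃ M, ∀ t ∈ Icc 0 δ, ‖T t‖ ≤ M := by
  by_contra! H
  have hpos : ∀ n : ℕ, (0 : ℝ) < 1 / ((n : ℝ) + 1) := fun n => by positivity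
  -- The maximum with ‖T 0‖ rules out s n = 0, so strong continuity along 𝓝[>] 0 applies.
  choose s hs hsM using fun n : ℕ =>
    H (1 / ((n : ℝ) + 1)) (hpos n) (max n ‖T 0‖)
  have hs0 : ∀ n, 0 < s n := fun n => by
    refine lt_of_le_of_ne (hs n).1 fun h => ?_
    have := hsM n
    rw [← h] at this
    exact absurd (le_max_right _ _) (not_le.2 this)
  have hlim : Tendsto s atTop (𝓝[>] 0) := by
    refine tendsto_nhdsWithin_iff.2 ⟨?_, Eventually.of_forall hs0⟩
    exact squeeze_zero (fun n => (hs n).1) (fun n => (hs n).2) tendsto_one_div_add_atTop_nhds_zero_nat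
  have hbdd : ∀ x, ∃ C, ∀ n, ‖T (s n) x‖ ≤ C := fun x => by
    have h := ((hT.tendsto_zero x).comp hlim).norm.bddAbove_range
    obtain ⟨C, hC⟩ := h
    exact ⟨C, fun n => hC ⟨n, rfl⟩⟩
  obtain ⟨C, hC⟩ := banach_steinhaus hbdd
  obtain ⟨n, hn⟩ := exists_nat_gt C
  have h1 := hsM n
  have h2 := le_max_left (n : ℝ) ‖T 0‖
  have h3 := hC n
  linarith

/-- The bound near 0 propagates by doubling the interval, since T t is the square of T (t / 2). -/
theorem exists_bound (hT : IsC0Semigroup T) (b : ℝ) :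
    ∃ M, ∀ t ∈ Icc 0 b, ‖T t‖ ≤ M := by
  obtain ⟨δ, hδ, M, hM⟩ := hT.exists_bound_near_zero
  have key : ∀ n : ℕ, ∃ M, ∀ t ∈ Icc 0 (2 ^ n * δ), ‖T t‖ ≤ M := by
    intro n
    induction n with
    | zero => exact ⟨M, by simpa using hM⟩
    | succ n ih =>
      obtain ⟨M, hM⟩ := ih
      refine ⟨M * M, fun t ht => ?_⟩
      have ht2 : t / 2 ∈ Icc 0 (2 ^ n * δ) := by
        refine ⟨by linarith [ht.1], ?_⟩
        have := ht.2
        rw [pow_succ] at this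
        linarith
      have h0 : 0 ≤ t / 2 := ht2.1
      have : T t = (T (t / 2)).comp (T (t / 2)) := by
        rw [← hT.map_add _ _ h0 h0, add_halves]
      rw [this]
      refine (ContinuousLinearMap.opNorm_comp_le _ _).trans ?_
      have := hM _ ht2
      gcongr
      exact (norm_nonneg _).trans this
  obtain ⟨n, hn⟩ := pow_unbounded_of_one_lt (b / δ) (one_lt_two (α := ℝ))
  obtain ⟨M, hM⟩ := key n
  refine ⟨M, fun t ht => hM t ⟨ht.1, ht.2.trans ?_⟩⟩
  rw [div_lt_iff₀ hδ] at hn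
  exact hn.le

/-- Joint strong continuity of a `C₀`-semigroup. -/
theorem continuous_uncurry (hT : IsC0Semigroup T) :
    Continuous fun p : ℝ × X => T (max p.1 0) p.2 := by
  rw [continuous_iff_continuousAt]
  rintro ⟨t, x⟩
  obtain ⟨M, hM⟩ := hT.exists_bound (max t 0 + 1)
  have hmax : Tendsto (fun p : ℝ × X => max p.1 0) (𝓝 (t, x)) (𝓝 (max t 0)) :=
    (continuous_fst.max continuous_const).tendsto (t, x)
  have hev : ∀ᶠ p : ℝ × X in 𝓝 (t, x), max p.1 0 < max t 0 + 1 :=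
    hmax.eventually (gt_mem_nhds (by linarith))
  -- With M a bound on a slightly longer time interval, this majorises the increment: the first term
  -- moves the vector, the second moves the time.
  have hlim : Tendsto (fun p : ℝ × X => M * ‖p.2 - x‖ + M * ‖T |max p.1 0 - max t 0| x - x‖)
      (𝓝 (t, x)) (𝓝 (M * ‖x - x‖ + M * ‖x - x‖)) := by
    refine Tendsto.add ?_ ?_
    · exact ((continuous_snd.tendsto (t, x)).sub_const x).norm.const_mul M
    · have h0 : Tendsto (fun p : ℝ × X => max p.1 0 - max t 0) (𝓝 (t, x)) (𝓝 0) := by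
        simpa using hmax.sub_const (max t 0)
      exact (((hT.tendsto_abs x).comp h0).sub_const x).norm.const_mul M
  rw [sub_self, norm_zero, mul_zero, add_zero] at hlim
  refine tendsto_iff_norm_sub_tendsto_zero.2 (squeeze_zero' (Eventually.of_forall fun _ =>
    norm_nonneg _) ?_ hlim)
  filter_upwards [hev] with p hp
  have hp0 : 0 ≤ max p.1 0 := le_max_right _ _
  have ht0 : 0 ≤ max t 0 := le_max_right _ _
  have h1 := hM _ ⟨hp0, hp.le⟩
  have h2 := hM _ ⟨ht0, by linarith⟩
  calc ‖T (max p.1 0) p.2 - T (max t 0) x‖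
      = ‖T (max p.1 0) (p.2 - x) + (T (max p.1 0) x - T (max t 0) x)‖ := by
        rw [_root_.map_sub]; congr 1; abel
    _ ≤ _ := (norm_add_le _ _).trans (add_le_add ((T _).le_of_opNorm_le h1 _)
        (hT.norm_sub_le hp0 ht0 h1 h2 x))

theorem continuous_comp (hT : IsC0Semigroup T) {Y : Type*} [TopologicalSpace Y] {g : Y → ℝ}
    {f : Y → X} (hg : Continuous g) (hf : Continuous f) :
    Continuous fun y => T (max (g y) 0) (f y) :=
  hT.continuous_uncurry.comp (hg.prodMk hf)

theorem continuous_orbit (hT : IsC0Semigroup T) (x : X) : Continuous fun s => T (max s 0) x :=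
  hT.continuous_comp continuous_id continuous_const

theorem continuousOn_orbit (hT : IsC0Semigroup T) (x : X) :
    ContinuousOn (fun s => T s x) (Ici 0) :=
  (hT.continuous_orbit x).continuousOn.congr fun s hs => by
    simp only [max_eq_left (mem_Ici.1 hs)]

theorem intervalIntegrable_orbit (hT : IsC0Semigroup T) (x : X) {a b : ℝ} (ha : 0 ≤ a)
    (hb : 0 ≤ b) : IntervalIntegrable (fun s => T s x) volume a b := by
  refine ((hT.continuousOn_orbit x).mono fun s hs => ?_).intervalIntegrable
  exact (le_min ha hb).trans hs.1

end IsC0Semigroup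

/-! ### Orbits of domain vectors and density of the domain. -/

section Generator

variable [NormedSpace ℝ X] [IsScalarTower ℝ 𝕜 X] {T : ℝ → X →L[𝕜] X}

/-- Removes the choice in `generator`, so that later arguments can work with difference quotients
instead of a partially defined map. -/
theorem generator_apply_eq_iff {x y : X} :
    (∃ h : x ∈ (generator T).domain, generator T ⟨x, h⟩ = y) ↔ HasGeneratorValue T x y := by
  constructor
  · rintro ⟨h, rfl⟩
    exact h.choose_spec
  · intro h
    exact ⟨⟨y, h⟩, tendsto_nhds_unique (Exists.choose_spec (p := HasGeneratorValue T x) ⟨y, h⟩) h⟩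

theorem hasGeneratorValue_generator (x : (generator T).domain) :
    HasGeneratorValue T x (generator T x) := x.2.choose_spec

theorem HasGeneratorValue.comp_clm {Y : Type*} [NormedAddCommGroup Y] [NormedSpace 𝕜 Y]
    [NormedSpace ℝ Y] [IsScalarTower ℝ 𝕜 Y] {T' : ℝ → Y →L[𝕜] Y} {x y : X} (B : X →L[𝕜] Y)
    (hB : ∀ t, 0 ≤ t → ∀ x, B (T t x) = T' t (B x)) (h : HasGeneratorValue T x y) :
    HasGeneratorValue T' (B x) (B y) := by
  refine ((B.continuous.tendsto y).comp h).congr' ?_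
  filter_upwards [self_mem_nhdsWithin] with t (ht : 0 < t)
  rw [Function.comp_apply, B.map_smul_of_tower, map_sub, hB t ht.le]

namespace IsC0Semigroup

theorem hasGeneratorValue_apply (hT : IsC0Semigroup T) {x y : X} (h : HasGeneratorValue T x y)
    {t : ℝ} (ht : 0 ≤ t) : HasGeneratorValue T (T t x) (T t y) :=
  h.comp_clm (T t) fun _ hs x => hT.comm_apply ht hs x

/-- The right derivative follows at once from the semigroup law. The two-sided one is recovered in
`hasDerivAt_apply` by writing the orbit as the integral of a continuous function. -/
theorem hasDerivWithinAt_right (hT : IsC0Semigroup T) {x y : X} (h : HasGeneratorValue T x y)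
    {t : ℝ} (ht : 0 ≤ t) : HasDerivWithinAt (fun s => T s x) (T t y) (Ioi t) t := by
  rw [hasDerivWithinAt_iff_tendsto_slope' (by simp)]
  have h1 := hT.hasGeneratorValue_apply h ht
  have h2 : Tendsto (fun s => s - t) (𝓝[>] t) (𝓝[>] 0) := by
    refine tendsto_nhdsWithin_iff.2 ⟨?_, ?_⟩
    · have : Tendsto (fun s => s - t) (𝓝 t) (𝓝 0) := by
        simpa using (continuous_sub_right t).tendsto t
      exact this.mono_left nhdsWithin_le_nhds
    · filter_upwards [self_mem_nhdsWithin] with s (hs : t < s)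
      exact sub_pos.2 hs
  refine (Tendsto.comp h1 h2).congr' ?_
  filter_upwards [self_mem_nhdsWithin] with s (hs : t < s)
  rw [Function.comp_apply, slope_def_module, ← hT.map_add_apply (sub_nonneg.2 hs.le) ht,
    sub_add_cancel]

variable [CompleteSpace X]

theorem integral_apply_generator (hT : IsC0Semigroup T) {x y : X} (h : HasGeneratorValue T x y)
    {t : ℝ} (ht : 0 ≤ t) : ∫ s in (0 : ℝ)..t, T s y = T t x - x := by
  rw [intervalIntegral.integral_eq_sub_of_hasDeriv_right_of_le ht
    (f := fun s => T s x) ((hT.continuousOn_orbit x).mono fun s hs => hs.1)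
    (fun s hs => hT.hasDerivWithinAt_right h hs.1.le) (hT.intervalIntegrable_orbit y le_rfl ht),
    hT.map_zero_apply]

theorem hasDerivAt_apply (hT : IsC0Semigroup T) {x y : X} (h : HasGeneratorValue T x y)
    {t : ℝ} (ht : 0 < t) : HasDerivAt (fun s => T s x) (T t y) t := by
  have h1 : HasDerivAt (fun s => x + ∫ r in (0 : ℝ)..s, T (max r 0) y) (T (max t 0) y) t :=
    ((hT.continuous_orbit y).integral_hasStrictDerivAt 0 t).hasDerivAt.const_add x
  rw [max_eq_left ht.le] at h1
  refine h1.congr_of_eventuallyEq ?_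
  filter_upwards [lt_mem_nhds ht] with s hs
  have : ∫ r in (0 : ℝ)..s, T (max r 0) y = ∫ r in (0 : ℝ)..s, T r y :=
    intervalIntegral.integral_congr fun r hr => by
      rw [uIcc_of_le hs.le] at hr
      simp only [max_eq_left hr.1]
  rw [this, hT.integral_apply_generator h hs.le]
  abel

omit [IsScalarTower ℝ 𝕜 X] in
-- T h shifts the interval of integration by h, so the increment is the integral over [t, t+h] minus
-- that over [0, h]; divided by h, these tend to T t x and x.
theorem hasGeneratorValue_integral (hT : IsC0Semigroup T) (x : X) {t : ℝ} (ht : 0 ≤ t) :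
    HasGeneratorValue T (∫ s in (0 : ℝ)..t, T s x) (T t x - x) := by
  have hc := hT.continuous_orbit x
  have h1 := (tendsto_integral_quotient hc t).sub (tendsto_integral_quotient hc 0)
  rw [max_self, hT.map_zero_apply, max_eq_left ht] at h1
  refine h1.congr' ?_
  filter_upwards [self_mem_nhdsWithin] with h (hh : 0 < h)
  have e1 : T h (∫ s in (0 : ℝ)..t, T s x) = ∫ s in h..(t + h), T (max s 0) x := by
    rw [← (T h).intervalIntegral_comp_comm (hT.intervalIntegrable_orbit x le_rfl ht)]
    have : ∫ s in h..(t + h), T (max s 0) x = ∫ s in (0 : ℝ)..t, T (max (s + h) 0) x := by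
      rw [intervalIntegral.integral_comp_add_right (fun s => T (max s 0) x), zero_add]
    rw [this]
    refine intervalIntegral.integral_congr fun r hr => ?_
    rw [uIcc_of_le ht] at hr
    rw [max_eq_left (by linarith [hr.1]), add_comm, hT.map_add_apply hh.le hr.1]
  have e2 : ∫ s in (0 : ℝ)..t, T s x = ∫ s in (0 : ℝ)..t, T (max s 0) x :=
    intervalIntegral.integral_congr fun r hr => by
      rw [uIcc_of_le ht] at hr
      simp only [max_eq_left hr.1]
  rw [e1, e2, ← smul_sub, zero_add]
  congr 1
  have hi := fun a b => hc.intervalIntegrable (μ := volume) a b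
  rw [intervalIntegral.integral_interval_sub_interval_comm (hi _ _) (hi _ _) (hi _ _),
    intervalIntegral.integral_symm 0 t, intervalIntegral.integral_symm h (t + h)]
  abel

/-- The averages of an orbit over [0, h] lie in the domain and converge to its starting point. -/
theorem dense_domain (hT : IsC0Semigroup T) : Dense {x | ∃ y, HasGeneratorValue T x y} := by
  intro x
  have h1 := tendsto_integral_quotient (hT.continuous_orbit x) 0
  rw [max_self, hT.map_zero_apply] at h1
  refine mem_closure_of_tendsto h1 ?_
  filter_upwards [self_mem_nhdsWithin] with h (hh : 0 < h)
  have e2 : ∫ s in (0 : ℝ)..(0 + h), T (max s 0) x = ∫ s in (0 : ℝ)..h, T s x := by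
    rw [zero_add]
    refine intervalIntegral.integral_congr fun r hr => ?_
    rw [uIcc_of_le hh.le] at hr
    simp only [max_eq_left hr.1]
  have h2 := (hT.hasGeneratorValue_integral x hh.le).smul ((h⁻¹ : ℝ) : 𝕜)
  rw [e2]
  refine ⟨((h⁻¹ : ℝ) : 𝕜) • (T h x - x), ?_⟩
  convert h2 using 1
  rw [← algebraMap_smul 𝕜 h⁻¹, RCLike.algebraMap_eq_ofReal]

end IsC0Semigroup

end Generator

end SemigroupTheory

end BCS

namespace BCS

/-! ### Rescaling and existence of a resolvent. -/

section ResolventTheory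

variable {𝕜 X : Type*} [RCLike 𝕜] [NormedAddCommGroup X] [NormedSpace 𝕜 X]

/-- The rescaled semigroup `t ↦ exp (-a t) T t`. -/
noncomputable def rescale (a : ℝ) (T : ℝ → X →L[𝕜] X) (t : ℝ) : X →L[𝕜] X :=
  ((Real.exp (-(a * t)) : ℝ) : 𝕜) • T t

variable {T : ℝ → X →L[𝕜] X}

theorem rescale_apply (a : ℝ) (t : ℝ) (x : X) :
    rescale a T t x = ((Real.exp (-(a * t)) : ℝ) : 𝕜) • T t x := rfl

theorem rescale_neg_rescale (a : ℝ) : rescale (-a) (rescale a T) = T := by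
  ext t x
  rw [rescale_apply, rescale_apply, smul_smul, ← RCLike.ofReal_mul, ← Real.exp_add]
  simp

theorem tendsto_exp_rescale (a : ℝ) :
    Tendsto (fun h : ℝ => ((Real.exp (-(a * h)) : ℝ) : 𝕜)) (𝓝[>] 0) (𝓝 1) := by
  have h : Continuous fun h : ℝ => ((Real.exp (-(a * h)) : ℝ) : 𝕜) :=
    RCLike.continuous_ofReal.comp (by fun_prop)
  have := (h.tendsto 0).mono_left (nhdsWithin_le_nhds (s := Ioi 0))
  simpa using this

theorem IsC0Semigroup.rescale (hT : IsC0Semigroup T) (a : ℝ) : IsC0Semigroup (rescale a T) where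
  map_zero := by
    ext x
    rw [rescale_apply, hT.map_zero]
    simp
  map_add s t hs ht := by
    ext x
    rw [ContinuousLinearMap.comp_apply, rescale_apply, rescale_apply, rescale_apply,
      hT.map_add_apply hs ht, map_smul, smul_smul, ← RCLike.ofReal_mul, ← Real.exp_add]
    congr 4
    ring
  tendsto_zero x := by
    simpa [rescale_apply] using (tendsto_exp_rescale (𝕜 := 𝕜) a).smul (hT.tendsto_zero x)

variable [NormedSpace ℝ X] [IsScalarTower ℝ 𝕜 X]

/-- Product rule at 0: the factor exp(-a t) replaces the generator A by A - a. -/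
theorem HasGeneratorValue.rescale {x y : X} (h : HasGeneratorValue T x y) (a : ℝ) :
    HasGeneratorValue (rescale a T) x (y - (a : 𝕜) • x) := by
  have hsm : ∀ (c : ℝ) (z : X), (c : 𝕜) • z = c • z := fun c z => by
    rw [← RCLike.algebraMap_eq_ofReal, algebraMap_smul]
  have h1 := (tendsto_exp_rescale (𝕜 := 𝕜) a).smul h
  have hd : HasDerivAt (fun h : ℝ => Real.exp (-(a * h))) (-a) 0 := by
    have := ((hasDerivAt_id (0 : ℝ)).const_mul a).neg.exp
    simpa using this
  have h2 := ((hasDerivAt_iff_tendsto_slope_zero.1 hd).mono_left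
    (nhdsWithin_mono (0 : ℝ) (s := Ioi 0) (fun x (hx : (0 : ℝ) < x) => hx.ne'))).smul_const x
  have h3 := h1.add h2
  rw [one_smul, neg_smul, ← sub_eq_add_neg, ← hsm a x] at h3
  refine h3.congr fun t => ?_
  rw [rescale_apply, hsm, hsm]
  simp only [zero_add, mul_zero, neg_zero, Real.exp_zero, smul_eq_mul, smul_sub, smul_smul]
  rw [mul_comm (t⁻¹) (Real.exp _), mul_sub, sub_smul, mul_one, mul_comm (t⁻¹) (Real.exp _)]
  abel

theorem hasGeneratorValue_rescale_iff {x y : X} (a : ℝ) :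
    HasGeneratorValue (rescale a T) x (y - (a : 𝕜) • x) ↔ HasGeneratorValue T x y := by
  refine ⟨fun h => ?_, fun h => h.rescale a⟩
  have h1 := h.rescale (-a)
  rw [rescale_neg_rescale] at h1
  simpa using h1

variable [CompleteSpace X]

/-- The bounded operator `x ↦ ∫₀ᵗ T s x ds`. -/
noncomputable def integralOperator (hT : IsC0Semigroup T) (t : ℝ) (ht : 0 ≤ t) : X →L[𝕜] X :=
  LinearMap.mkContinuous
    { toFun := fun x => ∫ s in (0 : ℝ)..t, T s x
      map_add' := fun x y => by
        simp only [map_add]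
        exact intervalIntegral.integral_add (hT.intervalIntegrable_orbit x le_rfl ht)
          (hT.intervalIntegrable_orbit y le_rfl ht)
      map_smul' := fun c x => by
        simp only [map_smul]
        exact intervalIntegral.integral_smul c _ }
    ((hT.exists_bound t).choose * t) fun x => by
      have h := intervalIntegral.norm_integral_le_of_norm_le_const (a := 0) (b := t)
        (f := fun s => T s x) (C := (hT.exists_bound t).choose * ‖x‖) fun s hs => by
          rw [uIoc_of_le ht] at hs
          exact (T s).le_of_opNorm_le ((hT.exists_bound t).choose_spec s ⟨hs.1.le, hs.2⟩) x
      rw [sub_zero, abs_of_nonneg ht] at h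
      refine h.trans_eq ?_
      ring

theorem integralOperator_apply (hT : IsC0Semigroup T) (t : ℝ) (ht : 0 ≤ t) (x : X) :
    integralOperator hT t ht x = ∫ s in (0 : ℝ)..t, T s x := rfl

theorem commute_integralOperator (hT : IsC0Semigroup T) (t : ℝ) (ht : 0 ≤ t) :
    Commute (integralOperator hT t ht) (T t) := by
  ext x
  rw [mul_apply_eq_comp, mul_apply_eq_comp, integralOperator_apply,
    integralOperator_apply, ← (T t).intervalIntegral_comp_comm
      (hT.intervalIntegrable_orbit x le_rfl ht)]
  refine intervalIntegral.integral_congr fun s hs => ?_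
  rw [uIcc_of_le ht] at hs
  exact hT.comm_apply hs.1 ht x

/-- The resolvent set of a generator is nonempty. -/
theorem IsC0Semigroup.resolventSet_generator_nonempty (hT : IsC0Semigroup T) :
    (resolventSet (generator T)).Nonempty := by
  -- This a makes 1 - S 1 invertible by a Neumann series, so integrating over [0, 1] suffices and no
  -- Laplace transform over the half-line is needed.
  obtain ⟨a, ha⟩ : ∃ a : ℝ, ‖BCS.rescale a T 1‖ < 1 := by
    refine ⟨Real.log (‖T 1‖ + 1), ?_⟩
    have hp : 0 < ‖T 1‖ + 1 := by positivity
    rw [BCS.rescale, norm_smul, mul_one, Real.exp_neg, Real.exp_log hp, RCLike.norm_ofReal,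
      abs_of_pos (inv_pos.2 hp), inv_mul_lt_iff₀ hp]
    linarith
  have hS := hT.rescale a
  set S := BCS.rescale a T with hSdef
  set K : (X →L[𝕜] X)ˣ := Units.oneSub (S 1) ha with hK
  have hKval : (K : X →L[𝕜] X) = 1 - S 1 := rfl
  set V := integralOperator hS 1 zero_le_one with hV
  set J : X →L[𝕜] X := ((K⁻¹ : (X →L[𝕜] X)ˣ) : X →L[𝕜] X) with hJ
  have hcomm : Commute V J := by
    refine Commute.units_inv_right ?_
    rw [hKval]
    exact (Commute.one_right V).sub_right (commute_integralOperator hS 1 zero_le_one)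
  have hmul : ∀ y, (1 - S 1) (J y) = y := fun y => by
    rw [← hKval, ← mul_apply_eq_comp, Units.mul_inv, one_apply_eq_self]
  have hmul' : ∀ y, J ((1 - S 1) y) = y := fun y => by
    rw [← hKval, ← mul_apply_eq_comp, Units.inv_mul, one_apply_eq_self]
  -- With V = ∫₀¹ S and J = (1 - S 1)⁻¹, integrating the generator along orbits gives V(a - A) = 1 -
  -- S 1 on D(A) and (a - A)V = 1 - S 1 on X. As V and J commute, V J is a two-sided inverse of a -
  -- A.
  refine ⟨(a : 𝕜), V * J, fun y => ?_, fun x => ?_⟩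
  · set z : X := J y with hz
    have h1 := hS.hasGeneratorValue_integral z zero_le_one
    have h2 : S 1 z - z = -y := by
      have h := hmul y
      rw [← hz, _root_.sub_apply, one_apply_eq_self] at h
      rw [← h, neg_sub]
    have h3 : HasGeneratorValue T (V z) ((a : 𝕜) • V z - y) := by
      rw [← hasGeneratorValue_rescale_iff a, sub_sub_cancel_left, ← h2]
      exact h1
    obtain ⟨hd, he⟩ := generator_apply_eq_iff.2 h3
    refine ⟨hd, ?_⟩
    change (a : 𝕜) • V z - generator T ⟨V z, hd⟩ = y
    rw [he, sub_sub_cancel]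
  · have h1 := (hasGeneratorValue_generator x).rescale a
    have h2 := hS.integral_apply_generator h1 zero_le_one
    have h3 : V ((a : 𝕜) • (x : X) - generator T x) = (1 - S 1) (x : X) := by
      rw [← neg_sub (generator T x), map_neg, integralOperator_apply, h2,
        _root_.sub_apply, one_apply_eq_self, neg_sub]
    rw [hcomm.eq, mul_apply_eq_comp, h3, hmul']

omit [CompleteSpace X]

/-- `R` is the resolvent of the generator of `T`, phrased by difference quotients. -/
theorem IsResolventAt.hasGeneratorValue {a : 𝕜} {R : X →L[𝕜] X}
    (hR : IsResolventAt (generator T) a R) (y : X) : HasGeneratorValue T (R y) (a • R y - y) := by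
  obtain ⟨h, hy⟩ := hR.1 y
  rw [← generator_apply_eq_iff]
  refine ⟨h, ?_⟩
  rw [eq_sub_iff_add_eq, ← eq_sub_iff_add_eq', hy]

theorem IsResolventAt.apply_of_hasGeneratorValue {a : 𝕜} {R : X →L[𝕜] X}
    (hR : IsResolventAt (generator T) a R) {x y : X} (h : HasGeneratorValue T x y) :
    R (a • x - y) = x := by
  obtain ⟨hx, rfl⟩ := generator_apply_eq_iff.2 h
  exact hR.2 ⟨x, hx⟩

/-- T t R y lies in the domain and a - A sends it to T t y; applying R gives the claim. -/
theorem IsResolventAt.comm {a : 𝕜} {R : X →L[𝕜] X}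
    (hR : IsResolventAt (generator T) a R) (hT : IsC0Semigroup T) {t : ℝ} (ht : 0 ≤ t) (y : X) :
    R (T t y) = T t (R y) := by
  have h := hR.apply_of_hasGeneratorValue (hT.hasGeneratorValue_apply (hR.hasGeneratorValue y) ht)
  rwa [← map_smul, ← _root_.map_sub, sub_sub_cancel] at h

end ResolventTheory

end BCS

namespace BCS

/-! ### Variation of constants and the inhomogeneous Cauchy problem. -/

section Convolution

variable {𝕜 X : Type*} [RCLike 𝕜] [NormedAddCommGroup X] [NormedSpace 𝕜 X] [NormedSpace ℝ X]

/-- The convolution `t ↦ ∫₀ᵗ T (t - r) f r dr`. -/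
noncomputable def convolution (T : ℝ → X →L[𝕜] X) (f : ℝ → X) (t : ℝ) : X :=
  ∫ r in (0 : ℝ)..t, T (t - r) (f r)

variable {T : ℝ → X →L[𝕜] X} {f : ℝ → X}

omit [NormedSpace ℝ X] in
theorem intervalIntegrable_convolution_congr {g : ℝ → X} {t : ℝ} (ht : 0 ≤ t)
    (h : EqOn f g (Icc 0 t)) (hg : IntervalIntegrable (fun r => T (t - r) (g r)) volume 0 t) :
    IntervalIntegrable (fun r => T (t - r) (f r)) volume 0 t := by
  refine hg.congr fun r hr => ?_
  rw [uIoc_of_le ht] at hr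
  simp only [h ⟨hr.1.le, hr.2⟩]

theorem convolution_congr {g : ℝ → X} {t : ℝ} (ht : 0 ≤ t) (h : EqOn f g (Icc 0 t)) :
    convolution T f t = convolution T g t :=
  intervalIntegral.integral_congr fun r hr => by
    rw [uIcc_of_le ht] at hr
    simp only [h hr]

theorem convolution_eq {t : ℝ} (ht : 0 ≤ t) :
    convolution T f t = ∫ r in (0 : ℝ)..t, T (max (t - r) 0) (f r) :=
  intervalIntegral.integral_congr fun r hr => by
    rw [uIcc_of_le ht] at hr
    simp only [max_eq_left (sub_nonneg.2 hr.2)]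

variable [CompleteSpace X]

namespace IsC0Semigroup

omit [NormedSpace ℝ X] in
theorem intervalIntegrable_convolution (hT : IsC0Semigroup T) (hf : Continuous f) {t : ℝ}
    (ht : 0 ≤ t) : IntervalIntegrable (fun r => T (t - r) (f r)) volume 0 t := by
  have h := hT.continuous_comp (continuous_sub_left t) hf
  refine (h.continuousOn.congr fun r hr => ?_).intervalIntegrable
  rw [uIcc_of_le ht] at hr
  rw [max_eq_left (sub_nonneg.2 hr.2)]

theorem continuous_integral_max (hT : IsC0Semigroup T) (hf : Continuous f) :
    Continuous fun t => ∫ r in (0 : ℝ)..t, T (max (t - r) 0) (f r) := by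
  refine intervalIntegral.continuous_parametric_intervalIntegral_of_continuous ?_ continuous_id
  exact hT.continuous_comp (continuous_fst.sub continuous_snd) (hf.comp continuous_snd)

variable [IsScalarTower ℝ 𝕜 X]

/-- The product rule for `s ↦ T (t - s) (z s)`. -/
theorem hasDerivAt_apply_sub (hT : IsC0Semigroup T) {z : ℝ → X} {z' y : X} {s t : ℝ} (hst : s < t)
    (hz : HasDerivAt z z' s) (hy : HasGeneratorValue T (z s) y) :
    HasDerivAt (fun r => T (max (t - r) 0) (z r)) (T (t - s) (z' - y)) s := by
  have hts : 0 < t - s := sub_pos.2 hst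
  rw [map_sub, sub_eq_add_neg]
  -- Split z r = z s + (z r - z s). The first part is an orbit of a domain vector run backwards; for
  -- the second, the difference quotient is T applied to the slope of z, which converges by joint
  -- continuity.
  have h1 : HasDerivAt (fun r => T (max (t - r) 0) (z s)) (-(T (t - s) y)) s := by
    have h := (hT.hasDerivAt_apply hy hts).scomp s ((hasDerivAt_id s).const_sub t)
    rw [neg_one_smul] at h
    refine h.congr_of_eventuallyEq ?_
    filter_upwards [gt_mem_nhds hst] with r hr
    simp only [Function.comp_apply, max_eq_left (sub_pos.2 hr).le]
  have h2 : HasDerivAt (fun r => T (max (t - r) 0) (z r - z s)) (T (t - s) z') s := by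
    rw [hasDerivAt_iff_tendsto_slope]
    have h3 := hasDerivAt_iff_tendsto_slope.1 hz
    have h4 : Tendsto (fun r => (t - r, slope z s r)) (𝓝[≠] s) (𝓝 (t - s, z')) :=
      (((continuous_sub_left t).tendsto s).mono_left nhdsWithin_le_nhds).prodMk_nhds h3
    have h5 := (hT.continuous_uncurry.tendsto (t - s, z')).comp h4
    simp only [max_eq_left hts.le] at h5
    refine h5.congr fun r => ?_
    simp only [Function.comp_apply, slope_def_module, sub_self, _root_.map_zero, sub_zero]
    rw [(T (max (t - r) 0)).map_smul_of_tower (r - s)⁻¹ (z r - z s)]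
  refine (h2.add h1).congr_of_eventuallyEq (Eventually.of_forall fun r => ?_)
  simp only [Pi.add_apply, map_sub, sub_add_cancel]

/-- A solution of the inhomogeneous equation is given by the variation of constants formula. -/
theorem eq_add_convolution (hT : IsC0Semigroup T) (hf : Continuous f) {z z' : ℝ → X} {t : ℝ}
    (ht : 0 ≤ t) (hc : ContinuousOn z (Icc 0 t)) (hd : ∀ s ∈ Ioo 0 t, HasDerivAt z (z' s) s)
    (hg : ∀ s ∈ Ioo 0 t, HasGeneratorValue T (z s) (z' s - f s)) :
    z t = T t (z 0) + convolution T f t := by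
  -- The derivative of r ↦ T (t - r) (z r) is T (t - r) (f r), because z' - Az = f.
  have h := intervalIntegral.integral_eq_sub_of_hasDerivAt_of_le ht
    (f := fun r => T (max (t - r) 0) (z r)) (f' := fun r => T (t - r) (f r)) ?_ (fun s hs => ?_)
    (hT.intervalIntegrable_convolution hf ht)
  · rw [sub_self, max_self, hT.map_zero_apply, sub_zero, max_eq_left ht] at h
    rw [convolution, h]
    abel
  · exact hT.continuous_uncurry.comp_continuousOn
      ((continuous_sub_left t).continuousOn.prodMk hc)
  · have := hT.hasDerivAt_apply_sub hs.2 (hd s hs) (hg s hs)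
    rwa [sub_sub_cancel] at this

variable {f' : ℝ → X}

/-- The convolution with a `C¹` function takes values in the domain of the generator. -/
theorem hasGeneratorValue_convolution (hT : IsC0Semigroup T) (hf : ∀ t, HasDerivAt f (f' t) t)
    (hf' : Continuous f') {t : ℝ} (ht : 0 ≤ t) :
    HasGeneratorValue T (convolution T f t) (T t (f 0) + convolution T f' t - f t) := by
  obtain ⟨a, R, hR⟩ := hT.resolventSet_generator_nonempty
  have hfc : Continuous f := continuous_iff_continuousAt.2 fun t => (hf t).continuousAt
  have hRf : ∀ t, HasDerivAt (fun t => R (f t)) (R (f' t)) t := fun t =>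
    (R.restrictScalars ℝ).hasFDerivAt.comp_hasDerivAt t (hf t)
  have hi : ∀ {g : ℝ → X}, Continuous g →
      convolution T (fun s => R (g s)) t = R (convolution T g t) := fun {g} hg => by
    rw [convolution, convolution,
      ← R.intervalIntegral_comp_comm (hT.intervalIntegrable_convolution hg ht)]
    refine intervalIntegral.integral_congr fun r hr => ?_
    rw [uIcc_of_le ht] at hr
    exact (hR.comm hT (sub_nonneg.2 hr.2) _).symm
  have hRc : ∀ {g : ℝ → X}, Continuous g → Continuous fun s => R (g s) := fun hg =>
    R.continuous.comp hg
  -- R f takes values in D(A), where A R f = a R f - f, so it solves the equation with forcing R f'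
  -- - (a R f - f).
  have h := hT.eq_add_convolution (f := fun s => R (f' s) - (a • R (f s) - f s))
    ((hRc hf').sub (((hRc hfc).const_smul a).sub hfc)) ht
    (hRc hfc).continuousOn (fun s _ => hRf s) (fun s _ => by
      rw [sub_sub_cancel]
      exact hR.hasGeneratorValue (f s))
  have h2 : convolution T (fun s => R (f' s) - (a • R (f s) - f s)) t
      = R (convolution T f' t) - (a • R (convolution T f t) - convolution T f t) := by
    rw [← hi hf', ← hi hfc, convolution, convolution, convolution, convolution,
      ← intervalIntegral.integral_smul, ← intervalIntegral.integral_sub,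
      ← intervalIntegral.integral_sub]
    · simp only [map_sub, map_smul]
    · exact hT.intervalIntegrable_convolution (hRc hf') ht
    · exact ((hT.intervalIntegrable_convolution (hRc hfc) ht).smul a).sub
        (hT.intervalIntegrable_convolution hfc ht)
    · exact (hT.intervalIntegrable_convolution (hRc hfc) ht).smul a
    · exact hT.intervalIntegrable_convolution hfc ht
  rw [h2, ← hR.comm hT ht] at h
  -- Solving the formula for the convolution displays it as a value of R, which gives both
  -- membership in D(A) and the value of A.
  have h3 : convolution T f t
      = R (a • convolution T f t - (T t (f 0) + convolution T f' t - f t)) := by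
    simp only [map_sub, _root_.map_add, map_smul]
    rw [h]
    abel
  have h4 := hR.hasGeneratorValue (a • convolution T f t - (T t (f 0) + convolution T f' t - f t))
  rw [← h3, sub_sub_cancel] at h4
  exact h4

omit [IsScalarTower ℝ 𝕜 X] in
theorem convolution_add (hT : IsC0Semigroup T) (hf : Continuous f) {t h : ℝ} (ht : 0 ≤ t)
    (hh : 0 ≤ h) : convolution T f (t + h)
      = T h (convolution T f t) + ∫ r in t..(t + h), T (max (t + h - r) 0) (f r) := by
  have hc := hT.continuous_comp (continuous_sub_left (t + h)) hf
  rw [convolution_eq (add_nonneg ht hh), ← intervalIntegral.integral_add_adjacent_intervals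
    (hc.intervalIntegrable 0 t) (hc.intervalIntegrable t (t + h)), convolution,
    ← (T h).intervalIntegral_comp_comm (hT.intervalIntegrable_convolution hf ht)]
  congr 1
  refine intervalIntegral.integral_congr fun r hr => ?_
  rw [uIcc_of_le ht] at hr
  have h0 := sub_nonneg.2 hr.2
  rw [← hT.map_add_apply hh h0, max_eq_left (by linarith)]
  congr 2
  ring

omit [IsScalarTower ℝ 𝕜 X] in
-- The integrand depends on h as well; substituting r = t + hσ fixes the interval to [0, 1] and
-- leaves continuity of a parametric integral at h = 0.
theorem tendsto_integral_convolution_quotient (hT : IsC0Semigroup T) (hf : Continuous f) (t : ℝ) :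
    Tendsto (fun h : ℝ => h⁻¹ • ∫ r in t..(t + h), T (max (t + h - r) 0) (f r)) (𝓝[>] 0)
      (𝓝 (f t)) := by
  have hc : Continuous fun h : ℝ =>
      ∫ σ in (0 : ℝ)..1, T (max (t + h - (t + h * σ)) 0) (f (t + h * σ)) := by
    refine intervalIntegral.continuous_parametric_intervalIntegral_of_continuous' ?_ 0 1
    exact hT.continuous_comp (by fun_prop) (hf.comp (by fun_prop))
  have h0 := (hc.tendsto 0).mono_left (nhdsWithin_le_nhds (s := Ioi 0))
  simp only [zero_mul, add_zero, sub_self, max_self, hT.map_zero_apply,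
    intervalIntegral.integral_const, sub_zero, one_smul] at h0
  refine h0.congr' ?_
  filter_upwards [self_mem_nhdsWithin] with h (hh : 0 < h)
  rw [eq_inv_smul_iff₀ hh.ne', intervalIntegral.smul_integral_comp_add_mul
    (fun r => T (max (t + h - r) 0) (f r)), mul_zero, add_zero, mul_one]

/-- The right derivative of T*f is A(T*f) + f = Tf(0) + T*f', which is continuous, so T*f is its
integral and hence C¹. -/
theorem convolution_eq_integral (hT : IsC0Semigroup T) (hf : ∀ t, HasDerivAt f (f' t) t)
    (hf' : Continuous f') {t : ℝ} (ht : 0 ≤ t) :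
    convolution T f t = ∫ s in (0 : ℝ)..t,
      (T (max s 0) (f 0) + ∫ r in (0 : ℝ)..s, T (max (s - r) 0) (f' r)) := by
  have hfc : Continuous f := continuous_iff_continuousAt.2 fun t => (hf t).continuousAt
  have hc : Continuous fun s =>
      T (max s 0) (f 0) + ∫ r in (0 : ℝ)..s, T (max (s - r) 0) (f' r) :=
    (hT.continuous_orbit (f 0)).add (hT.continuous_integral_max hf')
  rw [intervalIntegral.integral_eq_sub_of_hasDeriv_right_of_le ht (f := convolution T f) ?_
    (fun s hs => ?_) (hc.intervalIntegrable 0 t)]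
  · simp [convolution]
  · exact (hT.continuous_integral_max hfc).continuousOn.congr fun s hs => convolution_eq hs.1
  · rw [hasDerivWithinAt_iff_tendsto_slope' (by simp)]
    have h1 := Tendsto.add (hT.hasGeneratorValue_convolution hf hf' hs.1.le)
      (hT.tendsto_integral_convolution_quotient hfc s)
    rw [sub_add_cancel, convolution_eq (f := f') hs.1.le] at h1
    have h2 : Tendsto (fun r => r - s) (𝓝[>] s) (𝓝[>] 0) := by
      refine tendsto_nhdsWithin_iff.2 ⟨?_, ?_⟩
      · have : Tendsto (fun r => r - s) (𝓝 s) (𝓝 0) := by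
          simpa using (continuous_sub_right s).tendsto s
        exact this.mono_left nhdsWithin_le_nhds
      · filter_upwards [self_mem_nhdsWithin] with r (hr : s < r)
        exact sub_pos.2 hr
    rw [max_eq_left hs.1.le]
    refine (Tendsto.comp h1 h2).congr' ?_
    filter_upwards [self_mem_nhdsWithin] with r (hr : s < r)
    have h3 := hT.convolution_add hfc hs.1.le (sub_nonneg.2 hr.le)
    rw [add_sub_cancel] at h3
    rw [Function.comp_apply, slope_def_module, ← smul_add, h3, add_sub_cancel]
    congr 1
    abel

/-- The inhomogeneous equation with a `C¹` forcing term has a classical solution. -/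
theorem exists_solution (hT : IsC0Semigroup T) (hf : ∀ t, HasDerivAt f (f' t) t)
    (hf' : Continuous f') {z₀ y₀ : X} (hz₀ : HasGeneratorValue T z₀ y₀) :
    ∃ z w : ℝ → X, Continuous w ∧ (∀ t, HasDerivAt z (w t) t) ∧ ∀ t, 0 ≤ t →
      z t = T t z₀ + convolution T f t ∧ HasGeneratorValue T (z t) (w t - f t) := by
  set v : ℝ → X := fun s => T (max s 0) (f 0) + ∫ r in (0 : ℝ)..s, T (max (s - r) 0) (f' r) with hv
  have hc : Continuous v := (hT.continuous_orbit (f 0)).add (hT.continuous_integral_max hf')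
  have hy := hT.continuous_orbit y₀
  -- Written as a primitive of a continuous function on ℝ, z has two-sided derivatives everywhere;
  -- it equals T t z₀ + T*f only for t ≥ 0.
  refine ⟨fun t => z₀ + (∫ s in (0 : ℝ)..t, T (max s 0) y₀) + ∫ s in (0 : ℝ)..t, v s,
    fun t => T (max t 0) y₀ + v t, hy.add hc, fun t => ?_, fun t ht => ?_⟩
  · exact ((hy.integral_hasStrictDerivAt 0 t).hasDerivAt.const_add z₀).add
      (hc.integral_hasStrictDerivAt 0 t).hasDerivAt
  · have h1 : ∫ s in (0 : ℝ)..t, T (max s 0) y₀ = ∫ s in (0 : ℝ)..t, T s y₀ :=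
      intervalIntegral.integral_congr fun r hr => by
        rw [uIcc_of_le ht] at hr
        simp only [max_eq_left hr.1]
    have h2 : z₀ + (∫ s in (0 : ℝ)..t, T (max s 0) y₀) + ∫ s in (0 : ℝ)..t, v s
        = T t z₀ + convolution T f t := by
      rw [h1, hT.integral_apply_generator hz₀ ht, ← hT.convolution_eq_integral hf hf' ht,
        add_sub_cancel]
    refine ⟨h2, ?_⟩
    simp only [h2]
    have h3 := (hT.hasGeneratorValue_apply hz₀ ht).add (hT.hasGeneratorValue_convolution hf hf' ht)
    rw [hv]
    simp only
    rwa [max_eq_left ht, ← convolution_eq ht, add_sub_assoc]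

end IsC0Semigroup

end Convolution

end BCS

namespace BCS

/-! ### Transport of semigroups along an isometric isomorphism. -/

section Intertwining

variable {𝕜 X Y : Type*} [RCLike 𝕜] [NormedAddCommGroup X] [NormedSpace 𝕜 X]
  [NormedAddCommGroup Y] [NormedSpace 𝕜 Y] {T : ℝ → X →L[𝕜] X} {T' : ℝ → Y →L[𝕜] Y}

theorem symm_apply_of_intertwining (e : Y ≃ₗᵢ[𝕜] X)
    (he : ∀ t, 0 ≤ t → ∀ ξ, e (T' t ξ) = T t (e ξ)) {t : ℝ} (ht : 0 ≤ t) (x : X) :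
    e.symm (T t x) = T' t (e.symm x) := by
  rw [LinearIsometryEquiv.symm_apply_eq, he t ht, LinearIsometryEquiv.apply_symm_apply]

theorem IsC0Semigroup.of_intertwining (hT : IsC0Semigroup T) (e : Y ≃ₗᵢ[𝕜] X)
    (he : ∀ t, 0 ≤ t → ∀ ξ, e (T' t ξ) = T t (e ξ)) : IsC0Semigroup T' where
  map_zero := by
    ext ξ
    apply e.injective
    rw [he 0 le_rfl, hT.map_zero_apply, ContinuousLinearMap.id_apply]
  map_add s t hs ht := by
    ext ξ
    apply e.injective
    rw [ContinuousLinearMap.comp_apply, he _ (add_nonneg hs ht), he s hs, he t ht,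
      hT.map_add_apply hs ht]
  tendsto_zero ξ := by
    have h := (e.symm.continuous.tendsto _).comp (hT.tendsto_zero (e ξ))
    rw [LinearIsometryEquiv.symm_apply_apply] at h
    refine h.congr' ?_
    filter_upwards [self_mem_nhdsWithin] with t (ht : 0 < t)
    rw [Function.comp_apply, symm_apply_of_intertwining e he ht.le,
      LinearIsometryEquiv.symm_apply_apply]

variable [NormedSpace ℝ X] [IsScalarTower ℝ 𝕜 X] [NormedSpace ℝ Y] [IsScalarTower ℝ 𝕜 Y]

theorem hasGeneratorValue_iff_of_intertwining (e : Y ≃ₗᵢ[𝕜] X)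
    (he : ∀ t, 0 ≤ t → ∀ ξ, e (T' t ξ) = T t (e ξ)) {ξ η : Y} :
    HasGeneratorValue T' ξ η ↔ HasGeneratorValue T (e ξ) (e η) := by
  constructor
  · exact fun h => h.comp_clm (e.toContinuousLinearEquiv : Y →L[𝕜] X) he
  · intro h
    have h' := h.comp_clm (e.symm.toContinuousLinearEquiv : X →L[𝕜] Y) (T' := T')
      fun t ht x => symm_apply_of_intertwining e he ht x
    simpa using h'

omit [IsScalarTower ℝ 𝕜 Y] in
-- Here J stands for the embedding X → X₋₁ and e⁻¹(aR - I) for A₋₁. After applying e, all integrals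
-- live in X, where R commutes with T and can be pulled out.
theorem convolution_of_intertwining [CompleteSpace X] [CompleteSpace Y] (hT : IsC0Semigroup T)
    (e : Y ≃ₗᵢ[𝕜] X) (he : ∀ t, 0 ≤ t → ∀ ξ, e (T' t ξ) = T t (e ξ)) {J : X →L[𝕜] Y}
    {R : X →L[𝕜] X} {a : 𝕜} (hJ : ∀ x, e (J x) = R x)
    (hR : IsResolventAt (generator T) a R) {p q : ℝ → X} (hp : Continuous p) (hq : Continuous q)
    {t : ℝ} (ht : 0 ≤ t) {y : X} (hy : HasGeneratorValue T (convolution T q t) y) :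
    convolution T' (fun r => J (p r) - e.symm (a • R (q r) - q r)) t
      = J (convolution T p t - y) := by
  apply e.injective
  have hRc : ∀ {g : ℝ → X}, Continuous g → Continuous fun s => R (g s) := fun hg =>
    R.continuous.comp hg
  have hi := (hT.of_intertwining e he).intervalIntegrable_convolution
    (f := fun r => J (p r) - e.symm (a • R (q r) - q r)) ((J.continuous.comp hp).sub
      (e.symm.continuous.comp (((hRc hq).const_smul a).sub hq))) ht
  refine ((e.toContinuousLinearEquiv : Y →L[𝕜] X).intervalIntegral_comp_comm hi).symm.trans ?_
  have hip := hT.intervalIntegrable_convolution hp ht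
  have hiq := hT.intervalIntegrable_convolution hq ht
  have hRi : ∀ {g : ℝ → X}, IntervalIntegrable (fun r => T (t - r) (g r)) volume 0 t →
      IntervalIntegrable (fun r => R (T (t - r) (g r))) volume 0 t := fun hg =>
    ⟨R.integrable_comp hg.1, R.integrable_comp hg.2⟩
  have haRi : IntervalIntegrable (fun r => a • R (T (t - r) (q r))) volume 0 t :=
    (hRi hiq).smul a
  have h2 : ∫ r in (0 : ℝ)..t, (R (T (t - r) (p r))
      - (a • R (T (t - r) (q r)) - T (t - r) (q r)))
      = R (convolution T p t) - (a • R (convolution T q t) - convolution T q t) := by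
    rw [intervalIntegral.integral_sub (hRi hip) (haRi.sub hiq),
      intervalIntegral.integral_sub haRi hiq, intervalIntegral.integral_smul,
      R.intervalIntegral_comp_comm hip, R.intervalIntegral_comp_comm hiq]
    rfl
  have h3 : R (convolution T p t) - (a • R (convolution T q t) - convolution T q t)
      = R (convolution T p t - y) := by
    -- With c = T*q and y = Ac, R(ac - y) = c gives aRc - c = Ry.
    have := hR.apply_of_hasGeneratorValue hy
    rw [map_sub, map_smul] at this
    nth_rw 2 [← this]
    rw [sub_sub_cancel, map_sub]
  rw [hJ, ← h3, ← h2]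
  refine intervalIntegral.integral_congr fun r hr => ?_
  rw [uIcc_of_le ht] at hr
  have h0 := sub_nonneg.2 hr.2
  change e (T' (t - r) _) = _
  rw [he _ h0, map_sub e, hJ, LinearIsometryEquiv.apply_symm_apply, hR.comm hT h0,
    hR.comm hT h0, map_sub, map_sub, map_smul]

end Intertwining

/-! ### The extrapolation space, its semigroup and its generator. -/

section ExtrapolationTheory

variable {𝕜 X : Type*} [RCLike 𝕜] [NormedAddCommGroup X] [NormedSpace 𝕜 X]

theorem norm_toExtrapolation (A : X →ₗ.[𝕜] X) (a : 𝕜) (x : X) :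
    ‖toExtrapolation A a x‖ = ‖resolvent A a x‖ :=
  UniformSpace.Completion.norm_coe (toPullback (resolvent A a) x)

theorem denseRange_toExtrapolation (A : X →ₗ.[𝕜] X) (a : 𝕜) :
    DenseRange (toExtrapolation A a) :=
  UniformSpace.Completion.denseRange_coe (α := Pullback (resolvent A a))

variable [CompleteSpace X] [NormedSpace ℝ X] [IsScalarTower ℝ 𝕜 X] {T : ℝ → X →L[𝕜] X} {a : 𝕜}

theorem denseRange_resolvent (hT : IsC0Semigroup T) (ha : a ∈ resolventSet (generator T)) :
    DenseRange (resolvent (generator T) a) := by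
  refine hT.dense_domain.mono ?_
  rintro x ⟨y, hy⟩
  exact ⟨_, (resolvent_spec ha).apply_of_hasGeneratorValue hy⟩

/-- The isometric isomorphism `X₋₁ ≃ X` extending the resolvent. -/
noncomputable def extrapolationEquiv (hT : IsC0Semigroup T)
    (ha : a ∈ resolventSet (generator T)) : ExtrapolationSpace (generator T) a ≃ₗᵢ[𝕜] X :=
  (LinearEquiv.refl 𝕜 X).extendOfIsometry
    (toExtrapolation (generator T) a : X →ₗ[𝕜] ExtrapolationSpace (generator T) a)
    (resolvent (generator T) a : X →ₗ[𝕜] X)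
    (denseRange_toExtrapolation _ _) (denseRange_resolvent hT ha)
    fun x => (norm_toExtrapolation _ _ x).symm

theorem extrapolationEquiv_apply (hT : IsC0Semigroup T) (ha : a ∈ resolventSet (generator T))
    (x : X) : extrapolationEquiv hT ha (toExtrapolation (generator T) a x)
      = resolvent (generator T) a x :=
  LinearEquiv.extendOfIsometry_eq _ _ _ _ _ _ x

theorem extrapolationEquiv_symm_resolvent (hT : IsC0Semigroup T)
    (ha : a ∈ resolventSet (generator T)) (x : X) :
    (extrapolationEquiv hT ha).symm (resolvent (generator T) a x)
      = toExtrapolation (generator T) a x := by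
  rw [← extrapolationEquiv_apply hT ha, LinearIsometryEquiv.symm_apply_apply]

omit [CompleteSpace X] in
-- R commutes with T t, so T t is bounded by ‖T t‖ also for the norm ‖R x‖; this bound permits the
-- extension by continuity.
theorem extrapolatedSemigroup_toExtrapolation (hT : IsC0Semigroup T)
    (ha : a ∈ resolventSet (generator T)) {t : ℝ} (ht : 0 ≤ t) (x : X) :
    extrapolatedSemigroup (generator T) a T t (toExtrapolation (generator T) a x)
      = toExtrapolation (generator T) a (T t x) := by
  refine LinearMap.extendOfNorm_eq (denseRange_toExtrapolation _ _) ⟨‖T t‖, fun x => ?_⟩ x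
  change ‖toExtrapolation (generator T) a (T t x)‖ ≤ ‖T t‖ * ‖toExtrapolation (generator T) a x‖
  rw [norm_toExtrapolation, norm_toExtrapolation, (resolvent_spec ha).comm hT ht]
  exact (T t).le_opNorm _

theorem extrapolationEquiv_semigroup (hT : IsC0Semigroup T)
    (ha : a ∈ resolventSet (generator T)) {t : ℝ} (ht : 0 ≤ t)
    (ξ : ExtrapolationSpace (generator T) a) :
    extrapolationEquiv hT ha (extrapolatedSemigroup (generator T) a T t ξ)
      = T t (extrapolationEquiv hT ha ξ) := by
  refine (denseRange_toExtrapolation (generator T) a).induction_on ξ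
    (isClosed_eq (by fun_prop) (by fun_prop)) fun x => ?_
  rw [extrapolatedSemigroup_toExtrapolation hT ha ht, extrapolationEquiv_apply,
    extrapolationEquiv_apply, (resolvent_spec ha).comm hT ht]

theorem isC0Semigroup_extrapolatedSemigroup (hT : IsC0Semigroup T)
    (ha : a ∈ resolventSet (generator T)) :
    IsC0Semigroup (extrapolatedSemigroup (generator T) a T) :=
  hT.of_intertwining (extrapolationEquiv hT ha) fun _ ht => extrapolationEquiv_semigroup hT ha ht

theorem hasGeneratorValue_extrapolatedSemigroup_iff (hT : IsC0Semigroup T)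
    (ha : a ∈ resolventSet (generator T)) {ξ η : ExtrapolationSpace (generator T) a} :
    HasGeneratorValue (extrapolatedSemigroup (generator T) a T) ξ η ↔
      HasGeneratorValue T (extrapolationEquiv hT ha ξ) (extrapolationEquiv hT ha η) :=
  hasGeneratorValue_iff_of_intertwining (extrapolationEquiv hT ha)
    fun _ ht => extrapolationEquiv_semigroup hT ha ht

/-- A₋₁ = e⁻¹(aR - I) on X: the isometry sends x to R x ∈ D(A), and A R x = a R x - x. -/
theorem hasGeneratorValue_toExtrapolation (hT : IsC0Semigroup T)
    (ha : a ∈ resolventSet (generator T)) (x : X) :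
    HasGeneratorValue (extrapolatedSemigroup (generator T) a T)
      (toExtrapolation (generator T) a x)
      ((extrapolationEquiv hT ha).symm (a • resolvent (generator T) a x - x)) := by
  rw [hasGeneratorValue_extrapolatedSemigroup_iff hT ha, extrapolationEquiv_apply,
    LinearIsometryEquiv.apply_symm_apply]
  exact (resolvent_spec ha).hasGeneratorValue x

/-- The generator of the extrapolated semigroup has domain `X`. -/
theorem domain_extrapolatedGenerator (hT : IsC0Semigroup T)
    (ha : a ∈ resolventSet (generator T)) :
    ((extrapolatedGenerator (generator T) a T).domain :
      Set (ExtrapolationSpace (generator T) a)) = range (toExtrapolation (generator T) a) := by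
  ext ξ
  constructor
  · rintro ⟨η, h⟩
    rw [hasGeneratorValue_extrapolatedSemigroup_iff hT ha] at h
    refine ⟨a • extrapolationEquiv hT ha ξ - extrapolationEquiv hT ha η,
      (extrapolationEquiv hT ha).injective ?_⟩
    rw [extrapolationEquiv_apply]
    exact (resolvent_spec ha).apply_of_hasGeneratorValue h
  · rintro ⟨x, rfl⟩
    exact ⟨_, hasGeneratorValue_toExtrapolation hT ha x⟩

/-- The generator of the extrapolated semigroup extends the generator. -/
theorem mem_graph_extrapolatedGenerator (hT : IsC0Semigroup T)
    (ha : a ∈ resolventSet (generator T)) (x : (generator T).domain) :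
    (toExtrapolation (generator T) a (x : X), toExtrapolation (generator T) a (generator T x))
      ∈ (extrapolatedGenerator (generator T) a T).graph := by
  have h := hasGeneratorValue_toExtrapolation hT ha (x : X)
  have hx : (extrapolationEquiv hT ha).symm (a • resolvent (generator T) a (x : X) - (x : X))
      = toExtrapolation (generator T) a (generator T x) := by
    rw [← extrapolationEquiv_symm_resolvent hT ha]
    congr 1
    have := (resolvent_spec ha).2 x
    rw [map_sub, map_smul] at this
    nth_rw 2 [← this]
    exact sub_sub_cancel _ _
  rw [hx] at h
  obtain ⟨hd, he⟩ := generator_apply_eq_iff.2 h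
  exact (LinearPMap.mem_graph_iff _).2 ⟨⟨_, hd⟩, rfl, he⟩

/-- The generator of a convolution, expressed through a convolution in the extrapolation space. -/
theorem convolution_extrapolatedSemigroup (hT : IsC0Semigroup T)
    (ha : a ∈ resolventSet (generator T)) {p q : ℝ → X} (hp : Continuous p) (hq : Continuous q)
    {t : ℝ} (ht : 0 ≤ t) {y : X} (hy : HasGeneratorValue T (convolution T q t) y) :
    convolution (extrapolatedSemigroup (generator T) a T)
      (fun r => toExtrapolation (generator T) a (p r)
        - (extrapolationEquiv hT ha).symm (a • resolvent (generator T) a (q r) - q r)) t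
      = toExtrapolation (generator T) a (convolution T p t - y) :=
  convolution_of_intertwining hT (extrapolationEquiv hT ha)
    (fun _ ht => extrapolationEquiv_semigroup hT ha ht) (extrapolationEquiv_apply hT ha)
    (resolvent_spec ha) hp hq ht hy

end ExtrapolationTheory

end BCS

namespace BCS

/-! ### Extension of inputs from [0, τ] to ℝ. -/

section Extension

variable {E : Type*} [NormedAddCommGroup E] [NormedSpace ℝ E] [CompleteSpace E]

/-- Extending the derivative continuously and integrating it from w 0 extends w. Applied twice, this
yields C² extensions. -/
theorem exists_hasDerivAt_extension {τ : ℝ} {w w' g : ℝ → E}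
    (hw : ∀ t ∈ Icc 0 τ, HasDerivWithinAt w (w' t) (Icc 0 τ) t) (hg : Continuous g)
    (hgw : EqOn w' g (Icc 0 τ)) :
    ∃ v : ℝ → E, (∀ t, HasDerivAt v (g t) t) ∧ EqOn w v (Icc 0 τ) := by
  refine ⟨fun t => w 0 + ∫ s in (0 : ℝ)..t, g s, fun t =>
    (hg.integral_hasStrictDerivAt 0 t).hasDerivAt.const_add (w 0), fun t ht => ?_⟩
  simp only
  rw [intervalIntegral.integral_eq_sub_of_hasDerivAt_of_le ht.1 (f := w)
    (fun s hs => ((hw s ⟨hs.1, hs.2.trans ht.2⟩).continuousWithinAt).mono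
      (Icc_subset_Icc_right ht.2)) (fun s hs => ?_) (hg.intervalIntegrable 0 t), add_sub_cancel]
  have hs' : s ∈ Ioo 0 τ := ⟨hs.1, hs.2.trans_le ht.2⟩
  rw [← hgw ⟨hs'.1.le, hs'.2.le⟩]
  exact (hw s ⟨hs'.1.le, hs'.2.le⟩).hasDerivAt (Icc_mem_nhds hs'.1 hs'.2)

/-- A `C²` function on `[0, τ]` extends to a `C²` function on `ℝ`. -/
theorem exists_C2_extension {τ : ℝ} (hτ : 0 ≤ τ) {u : ℝ → E} (hu : ContDiffOn ℝ 2 u (Icc 0 τ)) :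
    ∃ v v' v'' : ℝ → E, (∀ t, HasDerivAt v (v' t) t) ∧ (∀ t, HasDerivAt v' (v'' t) t) ∧
      Continuous v'' ∧ EqOn u v (Icc 0 τ) ∧ EqOn (derivWithin u (Icc 0 τ)) v' (Icc 0 τ) := by
  -- For τ = 0 the interval is not a set of unique differentiability; an affine function whose slope
  -- is the value of `derivWithin` at 0 serves.
  rcases hτ.eq_or_lt with rfl | hτ
  · have hc : ∀ c : E, ∀ t : ℝ, HasDerivAt (fun _ : ℝ => c) ((fun _ => 0 : ℝ → E) t) t :=
      fun c t => hasDerivAt_const t c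
    set c := derivWithin u (Icc 0 0) 0 with hcdef
    refine ⟨fun t => u 0 + t • c, fun _ => c, fun _ => 0, fun t => ?_, hc c, continuous_const,
      ?_, ?_⟩
    · simpa using ((hasDerivAt_id t).smul_const c).const_add (u 0)
    all_goals
      intro t ht
      rw [Icc_self, mem_singleton_iff] at ht
      subst ht
      simp [hcdef]
  · have hud := uniqueDiffOn_Icc hτ
    have h1 : ContDiffOn ℝ 1 (derivWithin u (Icc 0 τ)) (Icc 0 τ) :=
      hu.derivWithin hud (by norm_num)
    have h2 : ContinuousOn (derivWithin (derivWithin u (Icc 0 τ)) (Icc 0 τ)) (Icc 0 τ) :=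
      h1.continuousOn_derivWithin hud le_rfl
    set g := IccExtend hτ.le ((Icc 0 τ).domRestrict
      (derivWithin (derivWithin u (Icc 0 τ)) (Icc 0 τ))) with hg
    have hgc : Continuous g := (continuousOn_iff_continuous_domRestrict.1 h2).Icc_extend'
    obtain ⟨v', hv', he'⟩ := exists_hasDerivAt_extension (τ := τ) (g := g)
      (fun t ht => (h1.differentiableOn (by norm_num) t ht).hasDerivWithinAt) hgc
      (fun t ht => by rw [hg, IccExtend_of_mem hτ.le _ ht]; rfl)
    obtain ⟨v, hv, he⟩ := exists_hasDerivAt_extension (τ := τ) (g := v')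
      (fun t ht => (hu.differentiableOn (by norm_num) t ht).hasDerivWithinAt)
      (continuous_iff_continuousAt.2 fun t => (hv' t).continuousAt) he'
    exact ⟨v, v', g, hv, hv', hgc, he, he'⟩

end Extension

/-! ### Reduction of the control system to the inhomogeneous problem. -/

section ControlTheory

variable {𝕜 X U : Type*} [RCLike 𝕜]
  [NormedAddCommGroup X] [NormedSpace 𝕜 X] [NormedSpace ℝ X] [IsScalarTower ℝ 𝕜 X]
  [NormedAddCommGroup U] [NormedSpace 𝕜 U] {S : BoundaryControlSystem 𝕜 X U}

namespace BoundaryControlSystem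

theorem A_apply_eq_iff {x y : X} : (∃ h : x ∈ S.A.domain, S.A ⟨x, h⟩ = y) ↔
    ∃ h : x ∈ S.Ahat.domain, S.Ahat ⟨x, h⟩ = y ∧ S.Ghat ⟨x, S.domain_le h⟩ = 0 := by
  constructor
  · rintro ⟨h, rfl⟩
    obtain ⟨z, hz, hzx⟩ := h.1
    refine ⟨h.2, rfl, ?_⟩
    obtain rfl : z = ⟨x, S.domain_le h.2⟩ := Subtype.ext hzx
    exact hz
  · rintro ⟨h, rfl, h0⟩
    have hd : x ∈ S.A.domain := ⟨⟨⟨x, S.domain_le h⟩, h0, rfl⟩, h⟩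
    exact ⟨hd, rfl⟩

theorem hasGeneratorValue_iff {T : ℝ → X →L[𝕜] X} (hA : generator T = S.A) {x y : X} :
    HasGeneratorValue T x y ↔
      ∃ h : x ∈ S.Ahat.domain, S.Ahat ⟨x, h⟩ = y ∧ S.Ghat ⟨x, S.domain_le h⟩ = 0 := by
  rw [← A_apply_eq_iff, ← hA, generator_apply_eq_iff]

variable [NormedSpace ℝ U] [IsScalarTower ℝ 𝕜 U] [CompleteSpace X] {T : ℝ → X →L[𝕜] X}
  {τ : ℝ} {x₀ : X} {u v v' v'' : ℝ → U}

/-- ψ - Gv has zero boundary value, hence lies in D(A), and solves z' = Az + ÂGv - Gv'; variation of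
constants then determines it. -/
theorem eq_of_isClassicalSolution (hT : IsC0Semigroup T) (hA : generator T = S.A)
    (L : LiftingOperator S.Ahat S.Ghat) (hv : ∀ t, HasDerivAt v (v' t) t) (hv' : Continuous v')
    (huv : EqOn u v (Icc 0 τ)) {ψ : ℝ → X} (hψ : S.IsClassicalSolution τ x₀ u ψ) {t : ℝ}
    (ht : t ∈ Icc 0 τ) :
    ψ t = T t (x₀ - L.G (u 0)) + convolution T (fun r => L.AhatG (v r) - L.G (v' r)) t
      + L.G (u t) := by
  have hvc : Continuous v := continuous_iff_continuousAt.2 fun t => (hv t).continuousAt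
  have hGv : ∀ s, HasDerivAt (fun s => L.G (v s)) (L.G (v' s)) s := fun s =>
    (L.G.restrictScalars ℝ).hasFDerivAt.comp_hasDerivAt s (hv s)
  have h0 : (0 : ℝ) ∈ Icc 0 τ := ⟨le_rfl, ht.1.trans ht.2⟩
  classical
  -- Â ψ makes sense only on [0, τ]; the value 0 elsewhere plays no role.
  set ψ' : ℝ → X := fun s =>
    if hs : s ∈ Icc 0 τ then S.Ahat ⟨ψ s, hψ.mem_domain s hs⟩ else 0 with hψ'
  have h := hT.eq_add_convolution (f := fun r => L.AhatG (v r) - L.G (v' r))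
    (z := fun s => ψ s - L.G (v s)) (z' := fun s => ψ' s - L.G (v' s))
    ((L.AhatG.continuous.comp hvc).sub (L.G.continuous.comp hv')) ht.1 ?_ ?_ ?_
  · simp only [hψ.initial, ← huv ht, ← huv h0] at h
    rw [← h, sub_add_cancel]
  · exact (hψ.contDiffOn.continuousOn.mono (Icc_subset_Icc_right ht.2)).sub
      (L.G.continuous.comp hvc).continuousOn
  · intro s hs
    have hs' : s ∈ Ioo 0 τ := ⟨hs.1, hs.2.trans_le ht.2⟩
    have hs'' := Ioo_subset_Icc_self hs'
    refine HasDerivAt.sub ?_ (hGv s)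
    rw [hψ']
    simp only [dif_pos hs'']
    exact (hψ.hasDerivWithinAt s hs'').hasDerivAt (Icc_mem_nhds hs'.1 hs'.2)
  · intro s hs
    have hs'' : s ∈ Icc 0 τ := ⟨hs.1.le, hs.2.le.trans ht.2⟩
    rw [hasGeneratorValue_iff hA]
    refine ⟨S.Ahat.domain.sub_mem (hψ.mem_domain s hs'') (L.mem_domain _), ?_, ?_⟩
    · rw [hψ']
      simp only [dif_pos hs'']
      rw [sub_sub_sub_cancel_right, L.AhatG_apply]
      exact S.Ahat.map_sub ⟨_, hψ.mem_domain s hs''⟩ ⟨_, L.mem_domain _⟩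
    · refine (S.Ghat.map_sub ⟨_, S.domain_le (hψ.mem_domain s hs'')⟩
        ⟨_, L.mem_domain_Ghat (v s)⟩).trans ?_
      rw [hψ.boundary s hs'', L.Ghat_G, huv hs'', sub_self]

/-- Adding Gv to a solution of the homogenised problem restores the boundary value. The condition on
x₀ puts the initial value in D(A), and v ∈ C² makes the forcing term C¹. -/
theorem exists_isClassicalSolution (hT : IsC0Semigroup T) (hA : generator T = S.A)
    (L : LiftingOperator S.Ahat S.Ghat) (hτ : 0 ≤ τ) (hv : ∀ t, HasDerivAt v (v' t) t)
    (hv' : ∀ t, HasDerivAt v' (v'' t) t) (hv'' : Continuous v'') (huv : EqOn u v (Icc 0 τ))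
    (hx₀ : x₀ - L.G (u 0) ∈ S.A.domain) :
    ∃ φ : ℝ → X, S.IsClassicalSolution τ x₀ u φ := by
  have hvc' : Continuous v' := continuous_iff_continuousAt.2 fun t => (hv' t).continuousAt
  have hGv : ∀ s, HasDerivAt (fun s => L.G (v s)) (L.G (v' s)) s := fun s =>
    (L.G.restrictScalars ℝ).hasFDerivAt.comp_hasDerivAt s (hv s)
  have hGv' : ∀ s, HasDerivAt (fun s => L.G (v' s)) (L.G (v'' s)) s := fun s =>
    (L.G.restrictScalars ℝ).hasFDerivAt.comp_hasDerivAt s (hv' s)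
  have hAGv : ∀ s, HasDerivAt (fun s => L.AhatG (v s)) (L.AhatG (v' s)) s := fun s =>
    (L.AhatG.restrictScalars ℝ).hasFDerivAt.comp_hasDerivAt s (hv s)
  have hz₀ : HasGeneratorValue T (x₀ - L.G (u 0)) (S.A ⟨_, hx₀⟩) :=
    (hasGeneratorValue_iff hA).2 (A_apply_eq_iff.1 ⟨hx₀, rfl⟩)
  obtain ⟨z, w, hw, hzw, hz⟩ := hT.exists_solution (f := fun r => L.AhatG (v r) - L.G (v' r))
    (fun s => (hAGv s).sub (hGv' s))
    ((L.AhatG.continuous.comp hvc').sub (L.G.continuous.comp hv'')) hz₀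
  have hd : ∀ t, HasDerivAt (fun t => z t + L.G (v t)) (w t + L.G (v' t)) t := fun t =>
    (hzw t).add (hGv t)
  have h0 : (0 : ℝ) ∈ Icc 0 τ := ⟨le_rfl, hτ⟩
  have hgv := fun t (ht : t ∈ Icc 0 τ) => (hasGeneratorValue_iff hA).1 (hz t ht.1).2
  have hmem : ∀ t ∈ Icc 0 τ, z t + L.G (v t) ∈ S.Ahat.domain := fun t ht =>
    S.Ahat.domain.add_mem (hgv t ht).1 (L.mem_domain _)
  refine ⟨fun t => z t + L.G (v t), ?_, ?_, hmem, fun t ht => ?_, fun t ht => ?_⟩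
  · refine (contDiff_one_iff_deriv.2 ⟨fun t => (hd t).differentiableAt, ?_⟩).contDiffOn
    rw [funext fun t => (hd t).deriv]
    exact hw.add (L.G.continuous.comp hvc')
  · rw [(hz 0 le_rfl).1, hT.map_zero_apply, convolution, intervalIntegral.integral_same,
      ← huv h0, add_zero, sub_add_cancel]
  · have h1 : S.Ahat ⟨z t + L.G (v t), hmem t ht⟩ = w t + L.G (v' t) := by
      refine (S.Ahat.map_add ⟨_, (hgv t ht).1⟩ ⟨_, L.mem_domain _⟩).trans ?_
      rw [(hgv t ht).2.1, ← L.AhatG_apply]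
      abel
    rw [h1]
    exact (hd t).hasDerivWithinAt
  · refine (S.Ghat.map_add ⟨_, S.domain_le (hgv t ht).1⟩ ⟨_, L.mem_domain_Ghat _⟩).trans ?_
    rw [(hgv t ht).2.2, L.Ghat_G, zero_add, huv ht]

end BoundaryControlSystem

end ControlTheory

end BCS

/-! ### Assembly of the three representations. -/

theorem mainTheorem3 {𝕜 X U : Type*} [RCLike 𝕜]
    [NormedAddCommGroup X] [NormedSpace 𝕜 X] [NormedSpace ℝ X] [IsScalarTower ℝ 𝕜 X]
    [CompleteSpace X]
    [NormedAddCommGroup U] [NormedSpace 𝕜 U] [NormedSpace ℝ U] [IsScalarTower ℝ 𝕜 U]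
    [CompleteSpace U]
    (S : BCS.BoundaryControlSystem 𝕜 X U)
    -- the semigroup generated by `A`
    (T : ℝ → X →L[𝕜] X) (hT : BCS.IsC0Semigroup T) (hA : BCS.generator T = S.A)
    -- an arbitrary lifting operator
    (L : BCS.LiftingOperator S.Ahat S.Ghat) :
    -- existence and uniqueness of classical solutions, first and second representation
    (∀ τ : ℝ, 0 ≤ τ → ∀ u : ℝ → U, ContDiffOn ℝ 2 u (Icc 0 τ) →
      ∀ x₀ : X, x₀ - L.G (u 0) ∈ S.A.domain →
      ∃ φ : ℝ → X, S.IsClassicalSolution τ x₀ u φ ∧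
        (∀ ψ : ℝ → X, S.IsClassicalSolution τ x₀ u ψ → EqOn ψ φ (Icc 0 τ)) ∧
        ∀ t ∈ Icc 0 τ,
          (IntervalIntegrable
              (fun r => T (t - r) (L.AhatG (u r) - L.G (derivWithin u (Icc 0 τ) r))) volume 0 t ∧
            φ t = T t (x₀ - L.G (u 0))
              + (∫ r in (0 : ℝ)..t, T (t - r) (L.AhatG (u r) - L.G (derivWithin u (Icc 0 τ) r)))
              + L.G (u t)) ∧
          IntervalIntegrable (fun r => T (t - r) (L.AhatG (u r))) volume 0 t ∧
          IntervalIntegrable (fun r => T (t - r) (L.G (u r))) volume 0 t ∧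
          ∃ h : (∫ r in (0 : ℝ)..t, T (t - r) (L.G (u r))) ∈ S.A.domain,
            φ t = T t x₀ + (∫ r in (0 : ℝ)..t, T (t - r) (L.AhatG (u r)))
              - S.A ⟨∫ r in (0 : ℝ)..t, T (t - r) (L.G (u r)), h⟩) ∧
    -- the extrapolation space can be formed, and for every admissible choice of its parameter:
    (BCS.resolventSet S.A).Nonempty ∧
    ∀ a ∈ BCS.resolventSet S.A,
      -- `T₋₁` is a `C₀`-semigroup on `X₋₁` extending `T`
      BCS.IsC0Semigroup (BCS.extrapolatedSemigroup S.A a T) ∧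
      (∀ t : ℝ, 0 ≤ t → ∀ x : X,
        BCS.extrapolatedSemigroup S.A a T t (BCS.toExtrapolation S.A a x)
          = BCS.toExtrapolation S.A a (T t x)) ∧
      -- its generator `A₋₁` has domain `X` and extends `A`
      ((BCS.extrapolatedGenerator S.A a T).domain : Set (BCS.ExtrapolationSpace S.A a))
          = range (BCS.toExtrapolation S.A a) ∧
      (∀ x : S.A.domain,
        (BCS.toExtrapolation S.A a (x : X), BCS.toExtrapolation S.A a (S.A x))
          ∈ (BCS.extrapolatedGenerator S.A a T).graph) ∧
      -- `A₋₁ G ∈ L(U, X₋₁)`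
      ∃ AG : U →L[𝕜] BCS.ExtrapolationSpace S.A a,
        (∀ v : U, ∃ h : BCS.toExtrapolation S.A a (L.G v)
              ∈ (BCS.extrapolatedGenerator S.A a T).domain,
            AG v = BCS.extrapolatedGenerator S.A a T ⟨BCS.toExtrapolation S.A a (L.G v), h⟩) ∧
        -- third representation
        ∀ τ : ℝ, 0 ≤ τ → ∀ u : ℝ → U, ContDiffOn ℝ 2 u (Icc 0 τ) →
          ∀ x₀ : X, x₀ - L.G (u 0) ∈ S.A.domain →
          ∀ φ : ℝ → X, S.IsClassicalSolution τ x₀ u φ →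
          ∀ t ∈ Icc 0 τ,
            IntervalIntegrable (fun r => BCS.extrapolatedSemigroup S.A a T (t - r)
              (((BCS.toExtrapolation S.A a).comp L.AhatG - AG) (u r))) volume 0 t ∧
            BCS.toExtrapolation S.A a (φ t)
              = BCS.toExtrapolation S.A a (T t x₀)
                + ∫ r in (0 : ℝ)..t, BCS.extrapolatedSemigroup S.A a T (t - r)
                    (((BCS.toExtrapolation S.A a).comp L.AhatG - AG) (u r)) := by
  have hgv : ∀ {x y : X}, BCS.HasGeneratorValue T x y ↔ ∃ h : x ∈ S.A.domain, S.A ⟨x, h⟩ = y := by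
    intro x y
    rw [← hA, BCS.generator_apply_eq_iff]
  -- consequences of a `C²` extension of the input
  have key : ∀ τ : ℝ, 0 ≤ τ → ∀ u : ℝ → U, ContDiffOn ℝ 2 u (Icc 0 τ) →
      ∃ v v' : ℝ → U, Continuous v ∧ Continuous v' ∧ EqOn u v (Icc 0 τ) ∧
        EqOn (derivWithin u (Icc 0 τ)) v' (Icc 0 τ) ∧
        ∀ x₀ : X, x₀ - L.G (u 0) ∈ S.A.domain → (∃ φ, S.IsClassicalSolution τ x₀ u φ) ∧
        ∀ φ, S.IsClassicalSolution τ x₀ u φ → ∀ t ∈ Icc 0 τ,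
          φ t = T t (x₀ - L.G (u 0))
            + BCS.convolution T (fun r => L.AhatG (v r) - L.G (v' r)) t + L.G (u t) ∧
          ∃ y, BCS.HasGeneratorValue T (BCS.convolution T (fun r => L.G (v r)) t) y ∧
            φ t = T t x₀ + BCS.convolution T (fun r => L.AhatG (v r)) t - y := by
    intro τ hτ u hu
    obtain ⟨v, v', v'', hv, hv', hv'', huv, huv'⟩ := BCS.exists_C2_extension hτ hu
    have hvc : Continuous v := continuous_iff_continuousAt.2 fun t => (hv t).continuousAt
    have hvc' : Continuous v' := continuous_iff_continuousAt.2 fun t => (hv' t).continuousAt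
    refine ⟨v, v', hvc, hvc', huv, huv', fun x₀ hx₀ =>
      ⟨S.exists_isClassicalSolution hT hA L hτ hv hv' hv'' huv hx₀, fun φ hφ t ht => ?_⟩⟩
    have h1 := S.eq_of_isClassicalSolution hT hA L hv hvc' huv hφ ht
    have hGv : ∀ s, HasDerivAt (fun s => L.G (v s)) (L.G (v' s)) s := fun s =>
      (L.G.restrictScalars ℝ).hasFDerivAt.comp_hasDerivAt s (hv s)
    have hGc' : Continuous fun s => L.G (v' s) := L.G.continuous.comp hvc'
    refine ⟨h1, _, hT.hasGeneratorValue_convolution hGv hGc' ht.1, ?_⟩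
    have h2 : BCS.convolution T (fun r => L.AhatG (v r) - L.G (v' r)) t
        = BCS.convolution T (fun r => L.AhatG (v r)) t
          - BCS.convolution T (fun r => L.G (v' r)) t := by
      simp only [BCS.convolution, map_sub]
      exact intervalIntegral.integral_sub
        (hT.intervalIntegrable_convolution (L.AhatG.continuous.comp hvc) ht.1)
        (hT.intervalIntegrable_convolution hGc' ht.1)
    -- The terms -T t G u(0), -T*(Gv') and G u(t) add up to minus the generator value of T*(Gv).
    rw [h1, h2, map_sub, huv ht, huv ⟨le_rfl, hτ⟩]
    abel
  refine ⟨fun τ hτ u hu x₀ hx₀ => ?_, ?_⟩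
  · obtain ⟨v, v', hvc, hvc', huv, huv', h⟩ := key τ hτ u hu
    obtain ⟨⟨φ, hφ⟩, hrep⟩ := h x₀ hx₀
    refine ⟨φ, hφ, fun ψ hψ t ht => (hrep ψ hψ t ht).1.trans (hrep φ hφ t ht).1.symm,
      fun t ht => ?_⟩
    obtain ⟨h1, y, hy, h2⟩ := hrep φ hφ t ht
    have hsub : Icc 0 t ⊆ Icc 0 τ := Icc_subset_Icc_right ht.2
    have e1 : EqOn (fun r => L.AhatG (u r) - L.G (derivWithin u (Icc 0 τ) r))
        (fun r => L.AhatG (v r) - L.G (v' r)) (Icc 0 t) := fun r hr => by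
      simp only [huv (hsub hr), huv' (hsub hr)]
    have e2 : EqOn (fun r => L.AhatG (u r)) (fun r => L.AhatG (v r)) (Icc 0 t) := fun r hr => by
      simp only [huv (hsub hr)]
    have e3 : EqOn (fun r => L.G (u r)) (fun r => L.G (v r)) (Icc 0 t) := fun r hr => by
      simp only [huv (hsub hr)]
    have hAc : Continuous fun r => L.AhatG (v r) := L.AhatG.continuous.comp hvc
    have hGc : Continuous fun r => L.G (v r) := L.G.continuous.comp hvc
    have hGc' : Continuous fun r => L.G (v' r) := L.G.continuous.comp hvc'
    rw [← BCS.convolution_congr ht.1 e1] at h1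
    rw [← BCS.convolution_congr ht.1 e2] at h2
    rw [← BCS.convolution_congr ht.1 e3, hgv] at hy
    obtain ⟨hd, rfl⟩ := hy
    exact ⟨⟨BCS.intervalIntegrable_convolution_congr ht.1 e1
        (hT.intervalIntegrable_convolution (hAc.sub hGc') ht.1), h1⟩,
      BCS.intervalIntegrable_convolution_congr ht.1 e2
        (hT.intervalIntegrable_convolution hAc ht.1),
      BCS.intervalIntegrable_convolution_congr ht.1 e3
        (hT.intervalIntegrable_convolution hGc ht.1), hd, h2⟩
  · rw [← hA] at key ⊢
    refine ⟨hT.resolventSet_generator_nonempty, fun a ha => ?_⟩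
    set R := BCS.resolvent (BCS.generator T) a
    refine ⟨BCS.isC0Semigroup_extrapolatedSemigroup hT ha,
      fun t ht x => BCS.extrapolatedSemigroup_toExtrapolation hT ha ht x,
      BCS.domain_extrapolatedGenerator hT ha, BCS.mem_graph_extrapolatedGenerator hT ha,
      -- The formula A₋₁ = e⁻¹(aR - I) on X shows that A₋₁ G = e⁻¹(aRG - G) is bounded.
      ((BCS.extrapolationEquiv hT ha).symm.toContinuousLinearEquiv : X →L[𝕜] _).comp
        (a • R.comp L.G - L.G), fun v => ?_, fun τ hτ u hu x₀ hx₀ φ hφ t ht => ?_⟩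
    · obtain ⟨hd, he⟩ := BCS.generator_apply_eq_iff.2
        (BCS.hasGeneratorValue_toExtrapolation hT ha (L.G v))
      exact ⟨hd, he.symm⟩
    · obtain ⟨v, v', hvc, -, huv, -, h⟩ := key τ hτ u hu
      obtain ⟨-, y, hy, h2⟩ := (h x₀ hx₀).2 φ hφ t ht
      have hAc : Continuous fun r => L.AhatG (v r) := L.AhatG.continuous.comp hvc
      have hGc : Continuous fun r => L.G (v r) := L.G.continuous.comp hvc
      -- With p = ÂGv and q = Gv, the X₋₁-valued integral is the image of T*(ÂGv) - A(T*(Gv)), as in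
      -- the second representation.
      have h3 := BCS.convolution_extrapolatedSemigroup hT ha hAc hGc ht.1 hy
      set B := (BCS.toExtrapolation (BCS.generator T) a).comp L.AhatG
        - ((BCS.extrapolationEquiv hT ha).symm.toContinuousLinearEquiv : X →L[𝕜] _).comp
          (a • R.comp L.G - L.G) with hB
      have e : EqOn (fun r => B (u r)) (fun r => B (v r)) (Icc 0 t) := fun r hr => by
        simp only [huv (Icc_subset_Icc_right ht.2 hr)]
      refine ⟨BCS.intervalIntegrable_convolution_congr ht.1 e
        ((BCS.isC0Semigroup_extrapolatedSemigroup hT ha).intervalIntegrable_convolution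
          (B.continuous.comp hvc) ht.1), ?_⟩
      rw [h2, add_sub_assoc, map_add, ← h3]
      congr 1
      exact (BCS.convolution_congr ht.1 e).symm
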